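/- For a Riemannian manifold $(M,g)$ with Levi-Civita connection $\nabla$, let $\pi:TM\to M$ be the projection, $K:TTM\to TM$ the connection map of $\nabla$, and, for $p\in\mathbb R$, $q\ge 0$, let $h_{p,q}$ be the generalised Cheeger-Gromoll metric on $TM$, $$h_{p,q}(A,B)=g(d\pi A,d\pi B)+\omega(e)^p\big[g(KA,KB)+q\,g(KA,e)\,g(KB,e)\big],\qquad A,B\in T_eTM,\quad \omega(e)=\frac1{1+|e|^2}.$$ A smooth map $\varphi$ between Riemannian manifolds is harmonic if its tension field $\tau(\varphi)=\operatorname{trace}\nabla d\varphi$ vanishes. Spheres $\mathbb S^m\subset\mathbb R^{m+1}$ carry the round metric $g$ of the unit sphere. (1) Let $n\ge 0$, $p>1$, $q\ge 0$, let $J$ be an orthogonal complex structure on $\mathbb R^{2n+2}$ (a linear isometry with $J^2=-1$), and let $k\in\mathbb R$ satisfy $k^2=\frac1{p-1}$. Then the scaled Hopf vector field $\sigma(x)=k\,Jx$ on $\mathbb S^{2n+1}$ is a harmonic map $(\mathbb S^{2n+1},g)\to(T\mathbb S^{2n+1},h_{p,q})$. (2) Let $m\ge 0$, $p\in\mathbb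 R$, $q\ge 0$, and let $\sigma$ be a smooth Killing vector field of constant norm on $\mathbb S^m$. Then the horizontal part of the tension field of $\sigma:(\mathbb S^m,g)\to(T\mathbb S^m,h_{p,q})$ vanishes, that is $d\pi(\tau(\sigma))=0$. If moreover $\sigma$ satisfies the equation of $(p,q)$-harmonic sections $$(1+|\sigma|^2)\nabla^*\nabla\sigma+2p\,\nabla_{X(\sigma)}\sigma=\Big[p|\nabla\sigma|^2-pq|X(\sigma)|^2-q(1+|\sigma|^2)\Delta\tfrac{|\sigma|^2}2\Big]\sigma,$$ where $\nabla^*\nabla=-\operatorname{trace}\nabla^2$, $\Delta=-\operatorname{trace}\nabla d$ and $X(\sigma)=\operatorname{grad}\tfrac{|\sigma|^2}2$, then $\sigma$ is a harmonic map $(\mathbb S^m,g)\to(T\mathbb S^m,h_{p,q})$. -/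

import Mathlib

set_option maxSynthPendingDepth 3

open scoped Manifold ContDiff RealInnerProductSpace

noncomputable section

namespace HarmonicHopf

/-! ### Riemannian calculus in charts

`TangentSpace I x` is the model space `E`, identified with the tangent space at `x` through the
preferred chart `extChartAt I x`. -/

section General

variable {E : Type*} [NormedAddCommGroup E] [NormedSpace ℝ E]
  {H : Type*} [TopologicalSpace H] (I : ModelWithCorners ℝ E H)
  {M : Type*} [TopologicalSpace M] [ChartedSpace H M]
  {E' : Type*} [NormedAddCommGroup E'] [NormedSpace ℝ E']
  {H' : Type*} [TopologicalSpace H'] (I' : ModelWithCorners ℝ E' H')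
  {M' : Type*} [TopologicalSpace M'] [ChartedSpace H' M']

variable (M) in
/-- A field of bilinear forms on the tangent spaces of `M`, such as a Riemannian metric. -/
abbrev MetricTensor : Type _ :=
  ∀ x : M, TangentSpace I x →L[ℝ] TangentSpace I x →L[ℝ] ℝ

/-- The value of a metric tensor at `x`, as a bilinear form on the model space. -/
def MetricTensor.at (g : MetricTensor I M) (x : M) : E →L[ℝ] E →L[ℝ] ℝ := g x

/-- The local expression of the metric `g` in the chart `extChartAt I x₀`, at the point `y` of the
target of that chart: the pull-back of `g` by the inverse of the chart. -/
def chartMetric (g : MetricTensor I M) (x₀ : M) (y : E) : E →L[ℝ] E →L[ℝ] ℝ :=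
  let D : E →L[ℝ] E := mfderiv 𝓘(ℝ, E) I (extChartAt I x₀).symm y
  (MetricTensor.at I g ((extChartAt I x₀).symm y)).bilinearComp D D

/-- The Christoffel symbols of the first kind of a field `G` of symmetric bilinear forms on a
vector space: `(u, v, w) ↦ (D_u G(v, w) + D_v G(u, w) - D_w G(u, v)) / 2` at the point `y`. -/
def christoffelFirst (G : E → E →L[ℝ] E →L[ℝ] ℝ) (y : E) : E →L[ℝ] E →L[ℝ] E →L[ℝ] ℝ :=
  let D : E →L[ℝ] E →L[ℝ] E →L[ℝ] ℝ := fderiv ℝ G y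
  let T : (E →L[ℝ] E →L[ℝ] ℝ) →L[ℝ] E →L[ℝ] E →L[ℝ] ℝ :=
    (ContinuousLinearMap.flipₗᵢ ℝ E E ℝ).toContinuousLinearEquiv
  (2⁻¹ : ℝ) • (D + D.flip - T.comp D.flip)

theorem christoffelFirst_apply (G : E → E →L[ℝ] E →L[ℝ] ℝ) (y u v w : E) :
    christoffelFirst G y u v w =
      2⁻¹ * (fderiv ℝ G y u v w + fderiv ℝ G y v u w - fderiv ℝ G y w u v) := by
  simp [christoffelFirst]

/-- The Christoffel symbols `Γ(u, v)` of the Levi-Civita connection of `g` in the chart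
`extChartAt I x₀` at the point `y`, characterised by
`G(Γ(u, v), w) = (D_u G(v, w) + D_v G(u, w) - D_w G(u, v)) / 2`, with `G` the local expression
of `g`. -/
def christoffel (g : MetricTensor I M) (x₀ : M) (y : E) : E →L[ℝ] E →L[ℝ] E :=
  (ContinuousLinearMap.compL ℝ E (E →L[ℝ] ℝ) E (chartMetric I g x₀ y).inverse).comp
    (christoffelFirst (chartMetric I g x₀) y)

theorem christoffel_apply (g : MetricTensor I M) (x₀ : M) (y u v : E) :
    christoffel I g x₀ y u v =
      (chartMetric I g x₀ y).inverse (christoffelFirst (chartMetric I g x₀) y u v) := rfl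

/-- The trace of a bilinear map `B` with respect to a nondegenerate form `G`:
`∑ᵢ B(bᵢ, ♯bⁱ)`, for a basis `b` with dual basis `bⁱ` and `♯` the inverse of `v ↦ G(v, ·)`.
It is the sum of `B(eᵢ, eᵢ)` over any `G`-orthonormal basis when `G` is positive definite. -/
def metricTrace [FiniteDimensional ℝ E] {F : Type*} [AddCommGroup F]
    (G : E →L[ℝ] E →L[ℝ] ℝ) (B : E → E → F) : F :=
  ∑ i, B (Module.finBasis ℝ E i)
    (G.inverse (LinearMap.toContinuousLinearMap ((Module.finBasis ℝ E).coord i)))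

/-! ### Maps between Riemannian manifolds -/

/-- The second fundamental form `(∇dφ)_x(u, v)` of a map `φ : (M, g) → (M', h)`, that is
`D²φ(u, v) - Dφ(Γ(u, v)) + Γ'(Dφ u, Dφ v)` in the preferred charts at `x` and `φ x`. -/
def secondFundamentalForm (g : MetricTensor I M) (h : MetricTensor I' M') (φ : M → M') (x : M)
    (u v : E) : TangentSpace I' (φ x) :=
  let f : E → E' := writtenInExtChartAt I I' x φ
  let y : E := extChartAt I x x
  (fderiv ℝ (fderiv ℝ f) y u v - fderiv ℝ f y (christoffel I g x y u v)
    + christoffel I' h (φ x) (f y) (fderiv ℝ f y u) (fderiv ℝ f y v) : E')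

/-- The tension field `τ(φ) = trace_g ∇dφ`. -/
def tensionField [FiniteDimensional ℝ E] (g : MetricTensor I M) (h : MetricTensor I' M')
    (φ : M → M') (x : M) : TangentSpace I' (φ x) :=
  metricTrace (MetricTensor.at I g x) (secondFundamentalForm I I' g h φ x)

/-- Harmonic maps: smooth maps with vanishing tension field. -/
def IsHarmonicMap [FiniteDimensional ℝ E] (g : MetricTensor I M) (h : MetricTensor I' M')
    (φ : M → M') : Prop :=
  ContMDiff I I' ∞ φ ∧ ∀ x, tensionField I I' g h φ x = 0

/-! ### Vector fields on a Riemannian manifold -/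

/-- A vector field in the chart `extChartAt I x₀`, as a function on the target of the chart. -/
def chartField (σ : ∀ x : M, TangentSpace I x) (x₀ : M) (y : E) : E :=
  let x : M := (extChartAt I x₀).symm y
  mfderiv I 𝓘(ℝ, E) (extChartAt I x₀) x (σ x)

/-- The covariant derivative `∇_u σ` in the chart `extChartAt I x₀`, at the point `y`. -/
def chartCovDeriv (g : MetricTensor I M) (σ : ∀ x : M, TangentSpace I x) (x₀ : M) (y u : E) : E :=
  fderiv ℝ (chartField I σ x₀) y u + christoffel I g x₀ y u (chartField I σ x₀ y)

/-- The covariant derivative `∇_u σ` at `x`. -/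
def covDeriv (g : MetricTensor I M) (σ : ∀ x : M, TangentSpace I x) (x : M)
    (u : TangentSpace I x) : TangentSpace I x :=
  let v : E := u
  (chartCovDeriv I g σ x (extChartAt I x x) v : E)

/-- The second covariant derivative `∇²_{u,v} σ = (∇_u ∇σ)(v)` at `x`. -/
def covDeriv₂ (g : MetricTensor I M) (σ : ∀ x : M, TangentSpace I x) (x : M)
    (u v : TangentSpace I x) : TangentSpace I x :=
  let y : E := extChartAt I x x
  (fderiv ℝ (fun z => chartCovDeriv I g σ x z v) y u
    + christoffel I g x y u (chartCovDeriv I g σ x y v)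
    - chartCovDeriv I g σ x y (christoffel I g x y u v) : E)

/-- The rough Laplacian `∇*∇σ = -trace ∇²σ`. -/
def roughLaplacian [FiniteDimensional ℝ E] (g : MetricTensor I M)
    (σ : ∀ x : M, TangentSpace I x) (x : M) : TangentSpace I x :=
  -metricTrace (MetricTensor.at I g x) (covDeriv₂ I g σ x)

/-- `|σ|²`. -/
def normSq (g : MetricTensor I M) (σ : ∀ x : M, TangentSpace I x) (x : M) : ℝ :=
  g x (σ x) (σ x)

/-- `|∇σ|²`. -/
def normSqCovDeriv [FiniteDimensional ℝ E] (g : MetricTensor I M)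
    (σ : ∀ x : M, TangentSpace I x) (x : M) : ℝ :=
  metricTrace (MetricTensor.at I g x) fun u v => g x (covDeriv I g σ x u) (covDeriv I g σ x v)

/-- The gradient of a function. -/
def gradient (g : MetricTensor I M) (f : M → ℝ) (x : M) : TangentSpace I x :=
  let df : E →L[ℝ] ℝ := mfderiv I 𝓘(ℝ, ℝ) f x
  ((MetricTensor.at I g x).inverse df : E)

/-- The Laplacian of a function, `Δf = -trace ∇df` (a nonnegative operator). -/
def laplacian [FiniteDimensional ℝ E] (g : MetricTensor I M) (f : M → ℝ) (x : M) : ℝ :=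
  let F : E → ℝ := f ∘ (extChartAt I x).symm
  let y : E := extChartAt I x x
  let hess : E → E → ℝ := fun u v =>
    fderiv ℝ (fderiv ℝ F) y u v - fderiv ℝ F y (christoffel I g x y u v)
  Neg.neg (metricTrace (MetricTensor.at I g x) hess)

/-- Killing's equation `g(∇_u σ, v) + g(u, ∇_v σ) = 0`. -/
def IsKilling (g : MetricTensor I M) (σ : ∀ x : M, TangentSpace I x) : Prop :=
  ∀ (x : M) (u v : TangentSpace I x),
    g x (covDeriv I g σ x u) v + g x u (covDeriv I g σ x v) = 0

/-- The equation of `(p, q)`-harmonic sections: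
`(1 + |σ|²) ∇*∇σ + 2p ∇_{X(σ)} σ = [p |∇σ|² - p q |X(σ)|² - q (1 + |σ|²) Δ(|σ|²/2)] σ`,
where `X(σ)` is the gradient of `|σ|²/2`. -/
def SectionEquation [FiniteDimensional ℝ E] (g : MetricTensor I M) (p q : ℝ)
    (σ : ∀ x : M, TangentSpace I x) : Prop :=
  let e : M → ℝ := fun x => normSq I g σ x / 2
  ∀ x : M,
    (1 + normSq I g σ x) • roughLaplacian I g σ x
        + (2 * p) • covDeriv I g σ x (gradient I g e x)
      = (p * normSqCovDeriv I g σ x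
          - p * q * g x (gradient I g e x) (gradient I g e x)
          - q * (1 + normSq I g σ x) * laplacian I g e x) • σ x

/-! ### The generalised Cheeger-Gromoll metrics on the tangent bundle -/

variable [IsManifold I 1 M]

/-- The differential `dπ : T_e TM → T_{π(e)} M` of the projection `π : TM → M`. -/
def dProj (e : TangentBundle I M) : E × E →L[ℝ] E :=
  mfderiv I.tangent I (fun e' : TangentBundle I M => e'.proj) e

/-- The connection map `K : T_e TM → T_{π(e)} M` of the Levi-Civita connection of `g`. In the
preferred chart of `TM` at `e`, which is induced by the preferred chart of `M` at `π(e)`, it is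
`K(u, w) = w + Γ(u, e)`. -/
def connectionMap (g : MetricTensor I M) (e : TangentBundle I M) : E × E →L[ℝ] E :=
  ContinuousLinearMap.snd ℝ E E +
    ((christoffel I g e.proj (extChartAt I e.proj e.proj)).flip e.snd).comp (dProj I e)

/-- The generalised Cheeger-Gromoll metric on `TM`,
`h_{p,q}(A, B) = g(dπ A, dπ B) + ω(e)^p [g(KA, KB) + q g(KA, e) g(KB, e)]`
for `A, B ∈ T_e TM`, with `ω(e) = 1 / (1 + |e|²)`. -/
def cheegerGromoll (g : MetricTensor I M) (p q : ℝ) : MetricTensor I.tangent (TangentBundle I M) :=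
  fun e =>
    let G : E →L[ℝ] E →L[ℝ] ℝ := MetricTensor.at I g e.proj
    let K : E × E →L[ℝ] E := connectionMap I g e
    let θ : E × E →L[ℝ] ℝ := (G.flip e.snd).comp K
    (G.bilinearComp (dProj I e) (dProj I e)
      + ((1 + G e.snd e.snd)⁻¹ ^ p) • (G.bilinearComp K K + q • θ.smulRight θ) :
        E × E →L[ℝ] E × E →L[ℝ] ℝ)

theorem cheegerGromoll_apply (g : MetricTensor I M) (p q : ℝ) (e : TangentBundle I M)
    (A B : E × E) :
    cheegerGromoll I g p q e A B =
      g e.proj (dProj I e A) (dProj I e B) + (1 + g e.proj e.snd e.snd)⁻¹ ^ p *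
        (g e.proj (connectionMap I g e A) (connectionMap I g e B)
          + q * (g e.proj (connectionMap I g e A) e.snd
            * g e.proj (connectionMap I g e B) e.snd)) := rfl

/-- A vector field as a map `M → TM`. -/
def toMap (σ : ∀ x : M, TangentSpace I x) : M → TangentBundle I M := fun x => ⟨x, σ x⟩

end General

/-! ### Round spheres and Hopf vector fields -/

/-- Euclidean space of dimension `m + 1`. -/
abbrev Ambient (m : ℕ) : Type := EuclideanSpace ℝ (Fin (m + 1))

/-- The unit sphere of dimension `m`. -/
abbrev Sph (m : ℕ) : Type := Metric.sphere (0 : Ambient m) 1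

/-- The differential at `x` of the inclusion of the sphere in Euclidean space. -/
def dIncl (m : ℕ) (x : Sph m) : EuclideanSpace ℝ (Fin m) →L[ℝ] Ambient m :=
  mfderiv (𝓡 m) 𝓘(ℝ, Ambient m) ((↑) : Sph m → Ambient m) x

/-- The round metric: the metric induced on the unit sphere by the Euclidean metric. -/
def roundMetric (m : ℕ) : MetricTensor (𝓡 m) (Sph m) := fun x =>
  ((innerSL ℝ : Ambient m →L[ℝ] Ambient m →L[ℝ] ℝ).bilinearComp (dIncl m x) (dIncl m x) :
    EuclideanSpace ℝ (Fin m) →L[ℝ] EuclideanSpace ℝ (Fin m) →L[ℝ] ℝ)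

theorem roundMetric_apply (m : ℕ) (x : Sph m) (u v : EuclideanSpace ℝ (Fin m)) :
    roundMetric m x u v = ⟪dIncl m x u, dIncl m x v⟫ := rfl

/-- The vector field `x ↦ k J x` on the unit sphere of dimension `m`; `dIncl_hopfField` shows that
it is well defined when `J` is an orthogonal complex structure. -/
def hopfField (m : ℕ) (J : Ambient m →ₗᵢ[ℝ] Ambient m) (k : ℝ) (x : Sph m) :
    TangentSpace (𝓡 m) x :=
  (Function.invFun (dIncl m x) (k • J x) : EuclideanSpace ℝ (Fin m))

theorem dIncl_hopfField (m : ℕ) (J : Ambient m →ₗᵢ[ℝ] Ambient m) (hJ : ∀ x, J (J x) = -x) (k : ℝ)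
    (x : Sph m) : dIncl m x (hopfField m J k x) = k • J x := by
  have := Fact.mk (@finrank_euclideanSpace_fin ℝ _ (m + 1))
  have h0 : ⟪(x : Ambient m), J x⟫ = 0 := by
    have h1 := J.inner_map_map (x : Ambient m) (J x)
    rw [hJ, inner_neg_right, real_inner_comm] at h1
    linarith
  have h2 : k • J x ∈ (dIncl m x).range := by
    have h3 := range_mfderiv_coe_sphere (n := m) x
    have h4 : k • J x ∈ (Submodule.span ℝ {(x : Ambient m)})ᗮ := by
      rw [Submodule.mem_orthogonal_singleton_iff_inner_right, inner_smul_right, h0, mul_zero]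
    rw [← h3] at h4
    exact h4
  obtain ⟨u, hu⟩ := h2
  exact Function.invFun_eq ⟨u, hu⟩

end HarmonicHopf

end

noncomputable section

namespace HarmonicHopf

/-! ### Inverses and traces of nondegenerate forms -/

section LinearAlgebra

variable {E : Type*} [NormedAddCommGroup E] [NormedSpace ℝ E] [FiniteDimensional ℝ E]

/-! Everything is computed after embedding the tangent bundle of the sphere in `V × V`, with `V` the
ambient Euclidean space. The tangential part of the second component of a velocity is its image
under K, so h_{p,q} is the restriction of the explicit `ambientForm`, which merely deletes the
component along x. Christoffel symbols of the first kind transform well under pull-back by any C²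
map, immersions into a larger space included (`christoffelFirst_pullback`). The stereographic chart
F centred at x has vanishing Christoffel symbols at its centre. Hence h(∇dσ(u, v), B) is an
expression in the first two derivatives of the ambient-valued field S representing σ
(`inner_secondFundamentalForm`).

For σ Killing of constant norm, S is orthogonal to D_uS and D_uS to u, and the terms in q cancel.
Summing over an orthonormal basis (`inner_tensionField`), the horizontal part of τ(σ) is -ω^p ∇_σσ.
It vanishes, because g(∇_σσ, v) = -g(σ, ∇_vσ) is minus half the derivative of |σ|² along v. What
remains is h(τ(σ), B) = ω^p g(-∇*∇σ + pω|∇σ|²σ, KB). When |σ| is constant the section equation reads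
(1 + |σ|²)∇*∇σ = p|∇σ|²σ, so it makes this pairing zero; `inner_roughLaplacian` and
`normSqCovDeriv_eq` provide the translation. Definiteness of h for q ≥ 0 then gives τ(σ) = 0.

For the Hopf field S = kJF is linear in F, and D²F(u, v) = -⟪u, v⟫x at the centre. In dimension m
this gives ∇*∇σ = (m - 1)σ and |∇σ|² = (m - 1)k², and the equation holds because 1 + k² = pk². -/

theorem inverse_apply_of_definite (G : E →L[ℝ] E →L[ℝ] ℝ) (hG : ∀ v, G v v = 0 → v = 0)
    (l : E →L[ℝ] ℝ) : G (G.inverse l) = l := by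
  -- Definiteness gives injectivity and equal dimensions give an equivalence; for a non-invertible
  -- map `inverse` would take its default value 0.
  have hinj : Function.Injective (G : E →ₗ[ℝ] E →L[ℝ] ℝ) := by
    rw [injective_iff_map_eq_zero]
    intro v hv
    exact hG v (by simpa using congrArg (fun f : E →L[ℝ] ℝ => f v) hv)
  have hdim : Module.finrank ℝ E = Module.finrank ℝ (E →L[ℝ] ℝ) := by
    rw [← (LinearMap.toContinuousLinearMap (𝕜 := ℝ) (E := E) (F' := ℝ)).finrank_eq]
    exact (Subspace.dual_finrank_eq (K := ℝ) (V := E)).symm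
  let e : E ≃L[ℝ] (E →L[ℝ] ℝ) :=
    (LinearMap.linearEquivOfInjective (G : E →ₗ[ℝ] E →L[ℝ] ℝ) hinj hdim).toContinuousLinearEquiv
  have he : G = (e : E →L[ℝ] (E →L[ℝ] ℝ)) := by
    ext v w
    rfl
  rw [he, ContinuousLinearMap.inverse_equiv]
  exact e.apply_symm_apply l

end LinearAlgebra

section Trace

variable {E : Type*} [NormedAddCommGroup E] [InnerProductSpace ℝ E] [FiniteDimensional ℝ E]

/-- Expanding the sharps of the dual basis in `e` gives a double sum, and summing over the arbitrary
basis first rebuilds each `e j`. The map `B'` certifies that `B` is bilinear. -/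
theorem metricTrace_eq_sum {F : Type*} [AddCommGroup F] [Module ℝ F]
    (G : E →L[ℝ] E →L[ℝ] ℝ) (hG : ∀ u v, G u v = ⟪u, v⟫) (B : E → E → F)
    (B' : E →ₗ[ℝ] E →ₗ[ℝ] F) (hB : ∀ u v, B u v = B' u v)
    {ι : Type*} [Fintype ι] (e : OrthonormalBasis ι ℝ E) :
    metricTrace G B = ∑ i, B (e i) (e i) := by
  have hinv : ∀ (l : E →L[ℝ] ℝ), G.inverse l = ∑ j, l (e j) • e j := by
    intro l
    rw [← e.sum_repr' (G.inverse l)]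
    refine Finset.sum_congr rfl fun j _ => ?_
    rw [real_inner_comm, ← hG, inverse_apply_of_definite G]
    intro v hv
    rwa [hG, inner_self_eq_zero] at hv
  simp only [metricTrace, hinv, hB]
  simp only [map_sum, map_smul]
  rw [Finset.sum_comm]
  refine Finset.sum_congr rfl fun j _ => ?_
  have hj : B' (e j) = ∑ i, (Module.finBasis ℝ E).repr (e j) i • B' (Module.finBasis ℝ E i) := by
    conv_lhs => rw [← (Module.finBasis ℝ E).sum_repr (e j)]
    rw [map_sum]
    simp only [map_smul]
  rw [hj, LinearMap.sum_apply]
  rfl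

end Trace

/-! ### Christoffel symbols of the first kind under pull-back -/

section Pullback

variable {Z W : Type*} [NormedAddCommGroup Z] [NormedSpace ℝ Z]
  [NormedAddCommGroup W] [NormedSpace ℝ W]

theorem fderiv_apply₂ {A B : Type*} [NormedAddCommGroup A] [NormedSpace ℝ A]
    [NormedAddCommGroup B] [NormedSpace ℝ B] {G : Z → A →L[ℝ] B →L[ℝ] W} {z : Z}
    (hG : DifferentiableAt ℝ G z) (u : Z) (a : A) (b : B) :
    fderiv ℝ G z u a b = fderiv ℝ (fun z => G z a b) z u := by
  rw [fderiv_clm_apply (by fun_prop) (by fun_prop)]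
  rw [fderiv_clm_apply (by fun_prop) (by fun_prop)]
  simp

theorem differentiableAt_bilinearComp {A : Type*} [NormedAddCommGroup A] [NormedSpace ℝ A]
    {k : Z → W →L[ℝ] W →L[ℝ] ℝ} {D : Z → A →L[ℝ] W} {z : Z}
    (hk : DifferentiableAt ℝ k z) (hD : DifferentiableAt ℝ D z) :
    DifferentiableAt ℝ (fun z => (k z).bilinearComp (D z) (D z)) z := by
  have h1 : DifferentiableAt ℝ (fun z => (k z).comp (D z)) z := hk.clm_comp hD
  have h2 : DifferentiableAt ℝ (fun z => ((k z).comp (D z)).flip) z :=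
    (ContinuousLinearMap.flipₗᵢ ℝ A W ℝ).toContinuousLinearEquiv.differentiableAt.comp z h1
  have h3 : DifferentiableAt ℝ (fun z => ((k z).comp (D z)).flip.comp (D z)) z := h2.clm_comp hD
  exact (ContinuousLinearMap.flipₗᵢ ℝ A A ℝ).toContinuousLinearEquiv.differentiableAt.comp z h3

/-- The Christoffel symbols of the first kind of a pull-back of a field of symmetric forms. -/
theorem christoffelFirst_pullback {k : W → W →L[ℝ] W →L[ℝ] ℝ} {Ψ : Z → W} {z : Z}
    (hk : DifferentiableAt ℝ k (Ψ z)) (hs : ∀ a b, k (Ψ z) a b = k (Ψ z) b a)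
    (hΨ : ContDiffAt ℝ 2 Ψ z) (u v w : Z) :
    christoffelFirst (fun z => (k (Ψ z)).bilinearComp (fderiv ℝ Ψ z) (fderiv ℝ Ψ z)) z u v w =
      k (Ψ z) (fderiv ℝ (fderiv ℝ Ψ) z u v) (fderiv ℝ Ψ z w)
        + christoffelFirst k (Ψ z) (fderiv ℝ Ψ z u) (fderiv ℝ Ψ z v) (fderiv ℝ Ψ z w) := by
  have hd : DifferentiableAt ℝ Ψ z := hΨ.differentiableAt (by norm_num)
  have hdd : DifferentiableAt ℝ (fderiv ℝ Ψ) z :=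
    (hΨ.fderiv_right (m := 1) (by norm_num)).differentiableAt (by norm_num)
  have hkΨ : DifferentiableAt ℝ (fun z => k (Ψ z)) z := hk.comp z hd
  have key : ∀ a b c : Z,
      fderiv ℝ (fun z => (k (Ψ z)).bilinearComp (fderiv ℝ Ψ z) (fderiv ℝ Ψ z)) z a b c =
        fderiv ℝ k (Ψ z) (fderiv ℝ Ψ z a) (fderiv ℝ Ψ z b) (fderiv ℝ Ψ z c)
        + k (Ψ z) (fderiv ℝ (fderiv ℝ Ψ) z a b) (fderiv ℝ Ψ z c)
        + k (Ψ z) (fderiv ℝ Ψ z b) (fderiv ℝ (fderiv ℝ Ψ) z a c) := by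
    intro a b c
    rw [fderiv_apply₂ (differentiableAt_bilinearComp hkΨ hdd)]
    simp only [ContinuousLinearMap.bilinearComp_apply]
    have hc : fderiv ℝ (fun z => k (Ψ z)) z = (fderiv ℝ k (Ψ z)).comp (fderiv ℝ Ψ z) :=
      fderiv_comp z hk hd
    have h1 : ∀ b, fderiv ℝ (fun z => fderiv ℝ Ψ z b) z a = fderiv ℝ (fderiv ℝ Ψ) z a b := by
      intro b
      rw [fderiv_clm_apply hdd (by fun_prop)]
      simp
    rw [fderiv_clm_apply (hkΨ.clm_apply (by fun_prop)) (by fun_prop)]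
    rw [fderiv_clm_apply hkΨ (by fun_prop)]
    simp only [hc, h1, add_apply, ContinuousLinearMap.comp_apply, ContinuousLinearMap.flip_apply]
    ring
  have hsym : ∀ a b, fderiv ℝ (fderiv ℝ Ψ) z a b = fderiv ℝ (fderiv ℝ Ψ) z b a := fun a b =>
    (hΨ.isSymmSndFDerivAt (by simp)) a b
  -- Six terms contain D²Ψ: by symmetry four cancel in pairs, and the other two are both k(D²Ψ(u,
  -- v), DΨ w).
  rw [christoffelFirst_apply, christoffelFirst_apply, key, key, key, hsym v u, hsym w u, hsym w v,
    hs (fderiv ℝ Ψ z v), hs (fderiv ℝ Ψ z u) (fderiv ℝ (fderiv ℝ Ψ) z v w)]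
  ring

end Pullback

/-! ### Inverse stereographic projection and its derivatives -/

section Stereographic

variable {V E : Type*} [NormedAddCommGroup V] [InnerProductSpace ℝ V]
  [NormedAddCommGroup E] [InnerProductSpace ℝ E]

/-- The inverse stereographic projection onto the unit sphere of `V`, centred at `x`. -/
def stereoParam (ι : E →ₗᵢ[ℝ] V) (x : V) (y : E) : V :=
  (‖y‖ ^ 2 + 4)⁻¹ • ((4 : ℝ) • ι y + (8 : ℝ) • x) - x

variable (ι : E →ₗᵢ[ℝ] V) (x : V)

theorem contDiff_stereoParam {n : ℕ∞ω} : ContDiff ℝ n (stereoParam ι x) := by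
  unfold stereoParam
  have h : ContDiff ℝ n fun y : E => (‖y‖ ^ 2 + 4)⁻¹ :=
    ((contDiff_norm_sq ℝ).add contDiff_const).inv fun y => by positivity
  have h2 : ContDiff ℝ n fun y : E => ι y := ι.toContinuousLinearMap.contDiff
  fun_prop

@[simp]
theorem stereoParam_zero : stereoParam ι x 0 = x := by
  simp only [stereoParam, norm_zero, map_zero, smul_zero, zero_add, smul_smul]
  rw [sub_eq_iff_eq_add, ← two_smul ℝ x]
  norm_num

theorem hasFDerivAt_inv_norm_sq (y : E) :
    HasFDerivAt (fun y : E => (‖y‖ ^ 2 + 4)⁻¹)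
      (-(2 * ((‖y‖ ^ 2 + 4)⁻¹) ^ 2) • innerSL ℝ y) y := by
  have h1 : HasFDerivAt (fun y : E => ‖y‖ ^ 2 + 4) (2 • innerSL ℝ y) y :=
    (hasStrictFDerivAt_norm_sq y).hasFDerivAt.add_const 4
  have h2 := (hasDerivAt_inv (x := ‖y‖ ^ 2 + 4) (by positivity)).comp_hasFDerivAt y h1
  refine h2.congr_fderiv ?_
  ext u
  simp
  ring

theorem fderiv_stereoParam_apply (y u : E) :
    fderiv ℝ (stereoParam ι x) y u = (4 * (‖y‖ ^ 2 + 4)⁻¹) • ι u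
      - (2 * ((‖y‖ ^ 2 + 4)⁻¹) ^ 2 * ⟪y, u⟫) • ((4 : ℝ) • ι y + (8 : ℝ) • x) := by
  have h1 : HasFDerivAt (fun y : E => (4 : ℝ) • ι y + (8 : ℝ) • x)
      ((4 : ℝ) • ι.toContinuousLinearMap) y :=
    (ι.toContinuousLinearMap.hasFDerivAt.const_smul (4 : ℝ)).add_const _
  have h2 := ((hasFDerivAt_inv_norm_sq y).smul h1).sub_const x
  have h3 : HasFDerivAt (stereoParam ι x) _ y := h2
  rw [h3.fderiv]
  simp only [LinearIsometry.coe_toContinuousLinearMap, add_apply, smul_apply,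
    ContinuousLinearMap.smulRight_apply, innerSL_apply_apply,
    smul_eq_mul]
  module

@[simp]
theorem fderiv_stereoParam_zero (u : E) : fderiv ℝ (stereoParam ι x) 0 u = ι u := by
  rw [fderiv_stereoParam_apply]
  norm_num

/-- At the centre the second derivative is purely normal: it is the second fundamental form of the
sphere. This is why the Christoffel symbols vanish there. -/
theorem fderiv_fderiv_stereoParam_zero (u v : E) :
    fderiv ℝ (fderiv ℝ (stereoParam ι x)) 0 u v = -⟪u, v⟫ • x := by
  have hd : DifferentiableAt ℝ (fderiv ℝ (stereoParam ι x)) 0 :=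
    ((contDiff_stereoParam ι x (n := 2)).fderiv_right (m := 1) (by norm_num)).differentiable
      (by norm_num) 0
  have h0 : fderiv ℝ (fderiv ℝ (stereoParam ι x)) 0 u v
      = fderiv ℝ (fun y => fderiv ℝ (stereoParam ι x) y v) 0 u := by
    rw [fderiv_clm_apply hd (by fun_prop)]
    simp
  rw [h0]
  simp only [fderiv_stereoParam_apply]
  have hr := hasFDerivAt_inv_norm_sq (0 : E)
  have h1 : HasFDerivAt (fun y : E => (4 : ℝ) • ι y + (8 : ℝ) • x)
      ((4 : ℝ) • ι.toContinuousLinearMap) 0 :=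
    (ι.toContinuousLinearMap.hasFDerivAt.const_smul (4 : ℝ)).add_const _
  have h2 : HasFDerivAt (fun y : E => ⟪y, v⟫) (innerSL ℝ v) 0 := by
    simpa only [real_inner_comm, innerSL_apply_apply] using! (innerSL ℝ v).hasFDerivAt (x := (0 : E))
  have h3 := ((hr.const_mul 4).smul_const (ι v)).sub ((((hr.pow 2).const_mul 2).mul h2).smul h1)
  erw [h3.fderiv]
  simp [smul_smul]
  norm_num
  rw [real_inner_comm]
  congr 1
  ring

variable {ι x}

/-- Stereographic projection is conformal. The factor is 1 to first order at y = 0. -/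
theorem inner_fderiv_stereoParam (hx : ‖x‖ = 1) (hι : ∀ u, ⟪x, ι u⟫ = 0) (y u v : E) :
    ⟪fderiv ℝ (stereoParam ι x) y u, fderiv ℝ (stereoParam ι x) y v⟫
      = (4 * (‖y‖ ^ 2 + 4)⁻¹) ^ 2 * ⟪u, v⟫ := by
  have hι' : ∀ u, ⟪ι u, x⟫ = 0 := fun u => by rw [real_inner_comm, hι]
  have hxx : ⟪x, x⟫ = 1 := by rw [real_inner_self_eq_norm_sq, hx]; norm_num
  have hyy : ⟪y, y⟫ = ‖y‖ ^ 2 := real_inner_self_eq_norm_sq y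
  have hr : (‖y‖ ^ 2 + 4)⁻¹ * (‖y‖ ^ 2 + 4) = 1 := inv_mul_cancel₀ (by positivity)
  simp only [fderiv_stereoParam_apply, inner_sub_left, inner_sub_right, inner_add_left,
    inner_add_right, real_inner_smul_left, real_inner_smul_right, hι, hι', hxx,
    LinearIsometry.inner_map_map, real_inner_comm y u, hyy]
  generalize (‖y‖ ^ 2 + 4)⁻¹ = r at *
  generalize ‖y‖ ^ 2 = a at *
  have ha : r * a = 1 - 4 * r := by linarith
  linear_combination (64 * r ^ 3 * ⟪y, u⟫ * ⟪y, v⟫) * ha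

theorem inner_stereoParam_self (hx : ‖x‖ = 1) (hι : ∀ u, ⟪x, ι u⟫ = 0) (y : E) :
    ⟪stereoParam ι x y, stereoParam ι x y⟫ = 1 := by
  have hι' : ∀ u, ⟪ι u, x⟫ = 0 := fun u => by rw [real_inner_comm, hι]
  have hxx : ⟪x, x⟫ = 1 := by rw [real_inner_self_eq_norm_sq, hx]; norm_num
  have hr : (‖y‖ ^ 2 + 4)⁻¹ * (‖y‖ ^ 2 + 4) = 1 := inv_mul_cancel₀ (by positivity)
  simp only [stereoParam, inner_sub_left, inner_sub_right, inner_add_left,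
    inner_add_right, real_inner_smul_left, real_inner_smul_right, hι, hι', hxx,
    LinearIsometry.inner_map_map, real_inner_self_eq_norm_sq y]
  generalize (‖y‖ ^ 2 + 4)⁻¹ = r at *
  generalize ‖y‖ ^ 2 = a at *
  have ha : r * a = 1 - 4 * r := by linarith
  linear_combination (16 * r) * ha

theorem inner_stereoParam_fderiv (hx : ‖x‖ = 1) (hι : ∀ u, ⟪x, ι u⟫ = 0) (y u : E) :
    ⟪stereoParam ι x y, fderiv ℝ (stereoParam ι x) y u⟫ = 0 := by
  have h1 : (fun y => ⟪stereoParam ι x y, stereoParam ι x y⟫) = fun _ => (1 : ℝ) :=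
    funext fun y => inner_stereoParam_self hx hι y
  have hd : DifferentiableAt ℝ (stereoParam ι x) y :=
    (contDiff_stereoParam ι x (n := 1)).differentiable (by norm_num) y
  have h2 := fderiv_inner_apply ℝ hd hd u
  rw [h1] at h2
  simp at h2
  rw [real_inner_comm (stereoParam ι x y)] at h2
  linarith

end Stereographic

/-! ### The preferred charts of the sphere and the round metric -/

section SphereCharts

variable {m : ℕ}

/-- The linear isometry onto the orthogonal complement of `x` underlying the preferred chart of
the sphere at `x`. -/
def tangentIsometry (x : Sph m) : EuclideanSpace ℝ (Fin m) →ₗᵢ[ℝ] Ambient m :=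
  have := Fact.mk (@finrank_euclideanSpace_fin ℝ _ (m + 1))
  (Submodule.subtypeₗᵢ _).comp
    (OrthonormalBasis.fromOrthogonalSpanSingleton (𝕜 := ℝ) m
      (ne_zero_of_mem_unit_sphere (-x))).repr.symm.toLinearIsometry

theorem norm_coe_sphere (x : Sph m) : ‖(x : Ambient m)‖ = 1 := by
  simp

theorem inner_tangentIsometry (x : Sph m) (u : EuclideanSpace ℝ (Fin m)) :
    ⟪(x : Ambient m), tangentIsometry x u⟫ = 0 := by
  have := Fact.mk (@finrank_euclideanSpace_fin ℝ _ (m + 1))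
  -- The preferred chart at x projects from the antipode -x, which is why -x spans the line whose
  -- complement is taken.
  have h := ((OrthonormalBasis.fromOrthogonalSpanSingleton (𝕜 := ℝ) m
      (ne_zero_of_mem_unit_sphere (-x))).repr.symm u).2
  rw [Submodule.mem_orthogonal_singleton_iff_inner_right] at h
  have h2 : ⟪-(x : Ambient m), tangentIsometry x u⟫ = 0 := h
  rw [inner_neg_left] at h2
  linarith

theorem tangentIsometry_inner (x : Sph m) (u : EuclideanSpace ℝ (Fin m)) :
    ⟪tangentIsometry x u, (x : Ambient m)⟫ = 0 := by
  rw [real_inner_comm, inner_tangentIsometry]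

theorem exists_tangentIsometry_eq (x : Sph m) (v : Ambient m) (h : ⟪(x : Ambient m), v⟫ = 0) :
    ∃ u, tangentIsometry x u = v := by
  have := Fact.mk (@finrank_euclideanSpace_fin ℝ _ (m + 1))
  have hv : v ∈ (Submodule.span ℝ {((-x : Sph m) : Ambient m)})ᗮ := by
    rw [Submodule.mem_orthogonal_singleton_iff_inner_right]
    change ⟪-(x : Ambient m), v⟫ = 0
    rw [inner_neg_left, h, neg_zero]
  refine ⟨(OrthonormalBasis.fromOrthogonalSpanSingleton (𝕜 := ℝ) m
      (ne_zero_of_mem_unit_sphere (-x))).repr ⟨v, hv⟩, ?_⟩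
  exact congrArg Subtype.val (LinearIsometryEquiv.symm_apply_apply _ _)

/-- The preferred chart of the sphere at `x`, seen as a map to the ambient space. -/
def sphereParam (x : Sph m) : EuclideanSpace ℝ (Fin m) → Ambient m :=
  stereoParam (tangentIsometry x) x

theorem contDiff_sphereParam (x : Sph m) {n : ℕ∞ω} : ContDiff ℝ n (sphereParam x) :=
  contDiff_stereoParam _ _

theorem differentiable_sphereParam (x : Sph m) : Differentiable ℝ (sphereParam x) :=
  (contDiff_sphereParam x (n := 1)).differentiable (by norm_num)

/-- The chart omits only -x, so its inverse is defined on the whole model space and chart identities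
hold at every y. -/
theorem extChartAt_target_sphere (x : Sph m) : (extChartAt (𝓡 m) x).target = Set.univ := by
  have := Fact.mk (@finrank_euclideanSpace_fin ℝ _ (m + 1))
  rw [extChartAt_target]
  change _ ⁻¹' (stereographic' m (-x)).target ∩ _ = _
  simp

theorem mem_extChartAt_target_sphere (x : Sph m) (y : EuclideanSpace ℝ (Fin m)) :
    y ∈ (extChartAt (𝓡 m) x).target := by
  rw [extChartAt_target_sphere]
  trivial

theorem coe_extChartAt_symm (x : Sph m) (y : EuclideanSpace ℝ (Fin m)) :
    ((extChartAt (𝓡 m) x).symm y : Ambient m) = sphereParam x y := by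
  have := Fact.mk (@finrank_euclideanSpace_fin ℝ _ (m + 1))
  have h := stereographic'_symm_apply (n := m) (-x) y
  have h1 : ((extChartAt (𝓡 m) x).symm y : Ambient m) = ((stereographic' m (-x)).symm y) := rfl
  rw [h1, h]
  have h2 : ‖tangentIsometry x y‖ = ‖y‖ := (tangentIsometry x).norm_map y
  have h3 : (((OrthonormalBasis.fromOrthogonalSpanSingleton (𝕜 := ℝ) m
      (ne_zero_of_mem_unit_sphere (-x))).repr.symm y : _) : Ambient m) = tangentIsometry x y := rfl
  simp only [h3, h2, sphereParam, stereoParam]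
  have hr : (‖y‖ ^ 2 + 4)⁻¹ * (‖y‖ ^ 2 + 4) = 1 := inv_mul_cancel₀ (by positivity)
  have h4 : ((-x : Sph m) : Ambient m) = -(x : Ambient m) := rfl
  rw [h4]
  generalize (‖y‖ ^ 2 + 4)⁻¹ = r at *
  have hr' : r * ‖y‖ ^ 2 = 1 - 4 * r := by linarith
  have h5 : (r * ‖y‖ ^ 2) • (x : Ambient m) = (1 - 4 * r) • (x : Ambient m) := by rw [hr']
  have h6 : r • (‖y‖ ^ 2 - 4) • (x : Ambient m)
      = (r * ‖y‖ ^ 2) • (x : Ambient m) - (4 * r) • (x : Ambient m) := by module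
  rw [smul_neg, smul_neg, h6, h5]
  module

theorem extChartAt_self_sphere (x : Sph m) : extChartAt (𝓡 m) x x = 0 := by
  have h : (extChartAt (𝓡 m) x).symm 0 = x := by
    apply Subtype.ext
    rw [coe_extChartAt_symm, sphereParam, stereoParam_zero]
  have h2 := (extChartAt (𝓡 m) x).right_inv (mem_extChartAt_target_sphere x 0)
  rwa [h] at h2

theorem extChartAt_symm_zero (x : Sph m) : (extChartAt (𝓡 m) x).symm 0 = x := by
  apply Subtype.ext
  rw [coe_extChartAt_symm, sphereParam, stereoParam_zero]

theorem mem_extChartAt_source_symm (x : Sph m) (y : EuclideanSpace ℝ (Fin m)) :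
    (extChartAt (𝓡 m) x).symm y ∈ (chartAt (EuclideanSpace ℝ (Fin m)) x).source := by
  rw [← extChartAt_source (𝓡 m)]
  exact (extChartAt (𝓡 m) x).map_target (mem_extChartAt_target_sphere x y)

/-- A tangent vector is represented in the preferred chart at its own base point, which is the
centre of that chart. -/
theorem dIncl_eq (x : Sph m) : dIncl m x = (tangentIsometry x).toContinuousLinearMap := by
  have := Fact.mk (@finrank_euclideanSpace_fin ℝ _ (m + 1))
  have hd : MDifferentiableAt (𝓡 m) 𝓘(ℝ, Ambient m) ((↑) : Sph m → Ambient m) x :=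
    (contMDiff_coe_sphere (m := 1)).mdifferentiable (by norm_num) x
  have hw : writtenInExtChartAt (𝓡 m) 𝓘(ℝ, Ambient m) x ((↑) : Sph m → Ambient m)
      = sphereParam x := by
    ext1 y
    simp only [writtenInExtChartAt, extChartAt_model_space_eq_id, Function.comp_apply]
    exact coe_extChartAt_symm x y
  unfold dIncl
  rw [hd.mfderiv, hw, extChartAt_self_sphere]
  have hr : Set.range (𝓡 m) = Set.univ := by simp
  rw [hr, fderivWithin_univ]
  ext1 u
  exact fderiv_stereoParam_zero _ _ u

theorem dIncl_mfderiv_extChartAt_symm (x : Sph m) (y u : EuclideanSpace ℝ (Fin m)) :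
    dIncl m ((extChartAt (𝓡 m) x).symm y)
      (mfderiv 𝓘(ℝ, EuclideanSpace ℝ (Fin m)) (𝓡 m) (extChartAt (𝓡 m) x).symm y u)
      = fderiv ℝ (sphereParam x) y u := by
  have := Fact.mk (@finrank_euclideanSpace_fin ℝ _ (m + 1))
  have hd : MDifferentiableAt (𝓡 m) 𝓘(ℝ, Ambient m) ((↑) : Sph m → Ambient m)
      ((extChartAt (𝓡 m) x).symm y) :=
    (contMDiff_coe_sphere (m := 1)).mdifferentiable (by norm_num) _
  have hs : MDifferentiableAt 𝓘(ℝ, EuclideanSpace ℝ (Fin m)) (𝓡 m) (extChartAt (𝓡 m) x).symm y := by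
    have h := mdifferentiableWithinAt_extChartAt_symm (I := 𝓡 m) (x := x) (z := y)
      (mem_extChartAt_target_sphere x y)
    have hr : Set.range (𝓡 m) = Set.univ := by simp
    rwa [hr, mdifferentiableWithinAt_univ] at h
  have hc : (fun z => ((extChartAt (𝓡 m) x).symm z : Ambient m)) = sphereParam x :=
    funext (coe_extChartAt_symm x)
  have h := mfderiv_comp_apply y hd hs u
  rw [← mfderiv_eq_fderiv, ← hc]
  exact h.symm

theorem dIncl_eq_fderiv_sphereParam (x : Sph m) (y : EuclideanSpace ℝ (Fin m))
    (v : EuclideanSpace ℝ (Fin m)) :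
    dIncl m ((extChartAt (𝓡 m) x).symm y) v = fderiv ℝ (sphereParam x) y
      (mfderiv (𝓡 m) 𝓘(ℝ, EuclideanSpace ℝ (Fin m)) (extChartAt (𝓡 m) x)
        ((extChartAt (𝓡 m) x).symm y) v) := by
  refine Eq.trans ?_ (dIncl_mfderiv_extChartAt_symm x y _)
  have h := mfderivWithin_extChartAt_symm_comp_mfderiv_extChartAt (I := 𝓡 m) (x := x) (y := y)
    (mem_extChartAt_target_sphere x y)
  have hr : Set.range (𝓡 m) = Set.univ := by simp
  rw [hr, mfderivWithin_univ] at h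
  congr 1
  exact (congrArg (fun f => f v) h).symm

theorem inner_fderiv_sphereParam (x : Sph m) (y u v : EuclideanSpace ℝ (Fin m)) :
    ⟪fderiv ℝ (sphereParam x) y u, fderiv ℝ (sphereParam x) y v⟫
      = (4 * (‖y‖ ^ 2 + 4)⁻¹) ^ 2 * ⟪u, v⟫ :=
  inner_fderiv_stereoParam (norm_coe_sphere x) (inner_tangentIsometry x) y u v

theorem roundMetric_at_apply (x : Sph m) (u v : EuclideanSpace ℝ (Fin m)) :
    MetricTensor.at (𝓡 m) (roundMetric m) x u v = ⟪u, v⟫ := by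
  change ⟪dIncl m x u, dIncl m x v⟫ = _
  rw [dIncl_eq]
  exact (tangentIsometry x).inner_map_map u v

theorem chartMetric_roundMetric (x : Sph m) : chartMetric (𝓡 m) (roundMetric m) x =
    fun y => (innerSL ℝ : Ambient m →L[ℝ] Ambient m →L[ℝ] ℝ).bilinearComp
      (fderiv ℝ (sphereParam x) y) (fderiv ℝ (sphereParam x) y) := by
  ext y u v
  change ⟪dIncl m _ (mfderiv _ _ _ _ u), dIncl m _ (mfderiv _ _ _ _ v)⟫ = _
  rw [dIncl_mfderiv_extChartAt_symm, dIncl_mfderiv_extChartAt_symm]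
  rfl

theorem chartMetric_roundMetric_definite (x : Sph m) (y v : EuclideanSpace ℝ (Fin m))
    (h : chartMetric (𝓡 m) (roundMetric m) x y v v = 0) : v = 0 := by
  rw [chartMetric_roundMetric] at h
  change ⟪fderiv ℝ (sphereParam x) y v, fderiv ℝ (sphereParam x) y v⟫ = 0 at h
  rw [inner_fderiv_sphereParam] at h
  have h4 : (4 * (‖y‖ ^ 2 + 4)⁻¹) ^ 2 ≠ 0 := by positivity
  simpa [h4] using h

/-- Gauss formula: the image of Γ(u, v) is the tangential part of D²F(u, v). The ambient form is
constant, so it contributes no symbols of its own. -/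
theorem inner_fderiv_christoffel (x : Sph m) (y u v w : EuclideanSpace ℝ (Fin m)) :
    ⟪fderiv ℝ (sphereParam x) y (christoffel (𝓡 m) (roundMetric m) x y u v),
      fderiv ℝ (sphereParam x) y w⟫
      = ⟪fderiv ℝ (fderiv ℝ (sphereParam x)) y u v, fderiv ℝ (sphereParam x) y w⟫ := by
  have h1 : ⟪fderiv ℝ (sphereParam x) y (christoffel (𝓡 m) (roundMetric m) x y u v),
      fderiv ℝ (sphereParam x) y w⟫
      = chartMetric (𝓡 m) (roundMetric m) x y (christoffel (𝓡 m) (roundMetric m) x y u v) w := by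
    rw [chartMetric_roundMetric]
    rfl
  rw [h1, christoffel_apply, inverse_apply_of_definite _ (chartMetric_roundMetric_definite x y),
    chartMetric_roundMetric]
  have h2 := christoffelFirst_pullback (z := y)
    (k := fun _ : Ambient m => (innerSL ℝ : Ambient m →L[ℝ] Ambient m →L[ℝ] ℝ))
    (differentiableAt_const _) (fun a b => real_inner_comm b a)
    ((contDiff_sphereParam x).contDiffAt) u v w
  refine h2.trans ?_
  rw [christoffelFirst_apply]
  simp only [fderiv_fun_const, Pi.zero_apply, zero_apply, add_zero, sub_zero, mul_zero]
  rfl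

theorem christoffel_zero (x : Sph m) : christoffel (𝓡 m) (roundMetric m) x 0 = 0 := by
  ext1 u
  ext1 v
  -- Pairing Γ(u, v) with itself gives 0, since D²F is normal at the centre.
  have h := inner_fderiv_christoffel x 0 u v (christoffel (𝓡 m) (roundMetric m) x 0 u v)
  rw [inner_fderiv_sphereParam] at h
  simp only [sphereParam, fderiv_fderiv_stereoParam_zero, fderiv_stereoParam_zero,
    real_inner_smul_left, inner_tangentIsometry, mul_zero] at h
  norm_num at h
  simpa using h

end SphereCharts

/-! ### The ambient form inducing the Cheeger-Gromoll metric -/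

section AmbientForm

variable {V : Type*} [NormedAddCommGroup V] [InnerProductSpace ℝ V]

/-- A field of bilinear forms on `V × V` that restricts to the generalised Cheeger-Gromoll metric
on the tangent bundle of the unit sphere of `V`, embedded in `V × V`. -/
def ambientForm (p q : ℝ) (z : V × V) : V × V →L[ℝ] V × V →L[ℝ] ℝ :=
  let α : V × V →L[ℝ] ℝ := (innerSL ℝ z.1).comp (ContinuousLinearMap.snd ℝ V V)
  let β : V × V →L[ℝ] ℝ := (innerSL ℝ z.2).comp (ContinuousLinearMap.snd ℝ V V)
  let g : V →L[ℝ] V →L[ℝ] ℝ := innerSL ℝ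
  g.bilinearComp (ContinuousLinearMap.fst ℝ V V) (ContinuousLinearMap.fst ℝ V V)
    + ((1 + ‖z.2‖ ^ 2)⁻¹ ^ p) •
      (g.bilinearComp (ContinuousLinearMap.snd ℝ V V) (ContinuousLinearMap.snd ℝ V V)
        - α.smulRight α + q • β.smulRight β)

theorem ambientForm_apply (p q : ℝ) (z A B : V × V) :
    ambientForm p q z A B = ⟪A.1, B.1⟫ + (1 + ‖z.2‖ ^ 2)⁻¹ ^ p *
      (⟪A.2, B.2⟫ - ⟪z.1, A.2⟫ * ⟪z.1, B.2⟫ + q * (⟪z.2, A.2⟫ * ⟪z.2, B.2⟫)) := by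
  rfl

theorem ambientForm_symm (p q : ℝ) (z A B : V × V) :
    ambientForm p q z A B = ambientForm p q z B A := by
  rw [ambientForm_apply, ambientForm_apply, real_inner_comm A.1 B.1, real_inner_comm A.2 B.2]
  ring

theorem contDiff_ambientForm [FiniteDimensional ℝ V] (p q : ℝ) :
    ContDiff ℝ 1 (ambientForm p q : V × V → _) := by
  have h : ContDiff ℝ 1 fun z : V × V => (1 + ‖z.2‖ ^ 2)⁻¹ ^ p := by
    refine ContDiff.rpow_const_of_ne ?_ fun z => by
      have : 0 < 1 + ‖z.2‖ ^ 2 := by positivity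
      exact (inv_pos.2 this).ne'
    exact (contDiff_const.add ((contDiff_norm_sq ℝ).comp contDiff_snd)).inv
      fun z => (show 0 < 1 + ‖z.2‖ ^ 2 by positivity).ne'
  rw [contDiff_clm_apply_iff]
  intro A
  rw [contDiff_clm_apply_iff]
  intro B
  simp only [ambientForm_apply]
  have h1 : ∀ c : V, ContDiff ℝ 1 fun z : V × V => ⟪z.1, c⟫ := fun c =>
    contDiff_fst.inner ℝ contDiff_const
  have h2 : ∀ c : V, ContDiff ℝ 1 fun z : V × V => ⟪z.2, c⟫ := fun c =>
    contDiff_snd.inner ℝ contDiff_const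
  exact contDiff_const.add (h.mul ((contDiff_const.sub ((h1 _).mul (h1 _))).add
    (contDiff_const.mul ((h2 _).mul (h2 _)))))

theorem fderiv_ambientForm_apply [FiniteDimensional ℝ V] (p q : ℝ) (z U A B : V × V) :
    fderiv ℝ (ambientForm p q) z U A B =
      -(2 * p * ⟪z.2, U.2⟫ * ((1 + ‖z.2‖ ^ 2)⁻¹ ^ p * (1 + ‖z.2‖ ^ 2)⁻¹)) *
        (⟪A.2, B.2⟫ - ⟪z.1, A.2⟫ * ⟪z.1, B.2⟫ + q * (⟪z.2, A.2⟫ * ⟪z.2, B.2⟫))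
      + (1 + ‖z.2‖ ^ 2)⁻¹ ^ p *
        (-(⟪U.1, A.2⟫ * ⟪z.1, B.2⟫) - ⟪z.1, A.2⟫ * ⟪U.1, B.2⟫
          + q * (⟪U.2, A.2⟫ * ⟪z.2, B.2⟫ + ⟪z.2, A.2⟫ * ⟪U.2, B.2⟫)) := by
  rw [fderiv_apply₂ ((contDiff_ambientForm p q).differentiable (by norm_num) z)]
  simp only [ambientForm_apply]
  have hi1 : ∀ c : V, HasFDerivAt (fun z : V × V => ⟪z.1, c⟫)
      ((innerSL ℝ c).comp (ContinuousLinearMap.fst ℝ V V)) z := fun c => by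
    have h := ((innerSL ℝ c).comp (ContinuousLinearMap.fst ℝ V V)).hasFDerivAt (x := z)
    refine h.congr_of_eventuallyEq (Filter.Eventually.of_forall fun z => ?_)
    exact real_inner_comm _ _
  have hi2 : ∀ c : V, HasFDerivAt (fun z : V × V => ⟪z.2, c⟫)
      ((innerSL ℝ c).comp (ContinuousLinearMap.snd ℝ V V)) z := fun c => by
    have h := ((innerSL ℝ c).comp (ContinuousLinearMap.snd ℝ V V)).hasFDerivAt (x := z)
    refine h.congr_of_eventuallyEq (Filter.Eventually.of_forall fun z => ?_)
    exact real_inner_comm _ _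
  have hn : HasFDerivAt (fun z : V × V => 1 + ‖z.2‖ ^ 2)
      ((2 • innerSL ℝ z.2).comp (ContinuousLinearMap.snd ℝ V V)) z :=
    ((hasStrictFDerivAt_norm_sq z.2).hasFDerivAt.comp z hasFDerivAt_snd).const_add 1
  have h0 : (1 + ‖z.2‖ ^ 2) ≠ 0 := by positivity
  have hω := ((hasDerivAt_inv h0).comp_hasFDerivAt z hn).rpow_const (p := p)
    (Or.inl (by simpa using h0))
  have h := (hω.mul (((hasFDerivAt_const ⟪A.2, B.2⟫ z).sub ((hi1 A.2).mul (hi1 B.2))).add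
    (((hi2 A.2).mul (hi2 B.2)).const_mul q))).const_add ⟪A.1, B.1⟫
  have h' : HasFDerivAt (fun z : V × V => ⟪A.1, B.1⟫ + (1 + ‖z.2‖ ^ 2)⁻¹ ^ p *
      (⟪A.2, B.2⟫ - ⟪z.1, A.2⟫ * ⟪z.1, B.2⟫ + q * (⟪z.2, A.2⟫ * ⟪z.2, B.2⟫))) _ z := h
  have hp : 0 < (1 + ‖z.2‖ ^ 2)⁻¹ := by positivity
  rw [h'.fderiv]
  simp only [add_apply, smul_apply, sub_apply, zero_apply, ContinuousLinearMap.comp_apply,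
    ContinuousLinearMap.coe_fst', ContinuousLinearMap.coe_snd', innerSL_apply_apply, Pi.add_apply,
    Pi.sub_apply, Pi.mul_apply, Function.comp_apply, smul_eq_mul, nsmul_eq_mul, Nat.cast_ofNat]
  rw [Real.rpow_sub_one hp.ne', real_inner_comm U.1 A.2, real_inner_comm U.1 B.2,
    real_inner_comm U.2 A.2, real_inner_comm U.2 B.2]
  -- The chain rule produces ω^(p-1) · ω², to be rewritten as ω^p · ω.
  have hz : (1 + ‖z.2‖ ^ 2)⁻¹ ^ p / (1 + ‖z.2‖ ^ 2)⁻¹ * ((1 + ‖z.2‖ ^ 2) ^ 2)⁻¹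
      = (1 + ‖z.2‖ ^ 2)⁻¹ ^ p * (1 + ‖z.2‖ ^ 2)⁻¹ := by
    field_simp
  linear_combination (-(2 * p * ⟪z.2, U.2⟫) *
    (⟪A.2, B.2⟫ - ⟪z.1, A.2⟫ * ⟪z.1, B.2⟫ + q * (⟪z.2, A.2⟫ * ⟪z.2, B.2⟫))) * hz

end AmbientForm

/-! ### Charts of the tangent bundle and its embedding -/

section TangentBundleChart

variable {m : ℕ}

/-- The embedding of the tangent bundle of the sphere in `V × V`. -/
def bundleIncl (e : TangentBundle (𝓡 m) (Sph m)) : Ambient m × Ambient m :=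
  (e.proj, dIncl m e.proj e.snd)

/-- The chart of the tangent bundle induced by the preferred chart of the sphere at `x`, seen as a
map to `V × V`. -/
def bundleParam (x : Sph m) (z : EuclideanSpace ℝ (Fin m) × EuclideanSpace ℝ (Fin m)) :
    Ambient m × Ambient m :=
  (sphereParam x z.1, fderiv ℝ (sphereParam x) z.1 z.2)

theorem contDiff_bundleParam (x : Sph m) {n : ℕ∞} : ContDiff ℝ n (bundleParam x) := by
  have h1 : ContDiff ℝ n (sphereParam x) := contDiff_sphereParam x
  have h2 : ContDiff ℝ n (fderiv ℝ (sphereParam x)) :=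
    (contDiff_sphereParam x (n := n + 1)).fderiv_right le_rfl
  unfold bundleParam
  fun_prop

theorem fderiv_bundleParam_apply (x : Sph m)
    (z A : EuclideanSpace ℝ (Fin m) × EuclideanSpace ℝ (Fin m)) :
    fderiv ℝ (bundleParam x) z A = (fderiv ℝ (sphereParam x) z.1 A.1,
      fderiv ℝ (fderiv ℝ (sphereParam x)) z.1 A.1 z.2 + fderiv ℝ (sphereParam x) z.1 A.2) := by
  have h1 : HasFDerivAt (sphereParam x) (fderiv ℝ (sphereParam x) z.1) z.1 :=
    (differentiable_sphereParam x z.1).hasFDerivAt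
  have h2 : HasFDerivAt (fderiv ℝ (sphereParam x)) (fderiv ℝ (fderiv ℝ (sphereParam x)) z.1) z.1 :=
    (((contDiff_sphereParam x (n := 2)).fderiv_right (m := 1) (by norm_num)).differentiable
      (by norm_num) z.1).hasFDerivAt
  have h3 : HasFDerivAt (bundleParam x) _ z := (h1.comp z hasFDerivAt_fst).prodMk
    ((h2.comp z hasFDerivAt_fst).clm_apply hasFDerivAt_snd)
  rw [h3.fderiv]
  simp [add_comm]

theorem fderiv_bundleParam_zero (x : Sph m) (w : EuclideanSpace ℝ (Fin m))
    (A : EuclideanSpace ℝ (Fin m) × EuclideanSpace ℝ (Fin m)) :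
    fderiv ℝ (bundleParam x) (0, w) A =
      (tangentIsometry x A.1, tangentIsometry x A.2 - ⟪A.1, w⟫ • (x : Ambient m)) := by
  rw [fderiv_bundleParam_apply]
  simp only [sphereParam, fderiv_fderiv_stereoParam_zero, fderiv_stereoParam_zero]
  refine Prod.ext rfl ?_
  simp only
  module

/-- The fibre coordinate is given by the coordinate change of the tangent bundle, which unfolds to
the derivative of the base chart. -/
theorem extChartAt_tangent_apply (e e' : TangentBundle (𝓡 m) (Sph m))
    (h : e'.proj ∈ (chartAt (EuclideanSpace ℝ (Fin m)) e.proj).source) :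
    extChartAt (𝓡 m).tangent e e' = (extChartAt (𝓡 m) e.proj e'.proj,
      mfderiv (𝓡 m) 𝓘(ℝ, EuclideanSpace ℝ (Fin m)) (extChartAt (𝓡 m) e.proj) e'.proj e'.snd) := by
  have hd : MDifferentiableAt (𝓡 m) 𝓘(ℝ, EuclideanSpace ℝ (Fin m)) (extChartAt (𝓡 m) e.proj) e'.proj :=
    mdifferentiableAt_extChartAt h
  refine Prod.ext rfl ?_
  rw [hd.mfderiv]
  rfl

theorem extChartAt_tangent_self (e : TangentBundle (𝓡 m) (Sph m)) :
    extChartAt (𝓡 m).tangent e e = ((0, e.snd) :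
      EuclideanSpace ℝ (Fin m) × EuclideanSpace ℝ (Fin m)) := by
  refine (extChartAt_tangent_apply e e (mem_chart_source _ _)).trans ?_
  rw [extChartAt_self_sphere, mfderiv_extChartAt_self]
  rfl

theorem mem_extChartAt_target_tangent (e : TangentBundle (𝓡 m) (Sph m))
    (z : EuclideanSpace ℝ (Fin m) × EuclideanSpace ℝ (Fin m)) :
    z ∈ (extChartAt (𝓡 m).tangent e).target := by
  have h : (extChartAt (𝓡 m).tangent e).target = _ :=
    FiberBundle.extChartAt_target (IB := 𝓡 m) (F := EuclideanSpace ℝ (Fin m)) e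
  rw [h]
  exact ⟨⟨mem_extChartAt_target_sphere _ _, mem_extChartAt_source_symm _ _⟩, trivial⟩

theorem proj_extChartAt_tangent_symm (e : TangentBundle (𝓡 m) (Sph m))
    (z : EuclideanSpace ℝ (Fin m) × EuclideanSpace ℝ (Fin m)) :
    ((extChartAt (𝓡 m).tangent e).symm z).proj = (extChartAt (𝓡 m) e.proj).symm z.1 := by
  rfl

theorem bundleIncl_extChartAt_symm (e : TangentBundle (𝓡 m) (Sph m))
    (z : EuclideanSpace ℝ (Fin m) × EuclideanSpace ℝ (Fin m)) :
    bundleIncl ((extChartAt (𝓡 m).tangent e).symm z) = bundleParam e.proj z := by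
  have h1 := (extChartAt (𝓡 m).tangent e).right_inv (mem_extChartAt_target_tangent e z)
  have h2 := proj_extChartAt_tangent_symm e z
  -- Only the base point of this vector and its coordinates in the chart matter.
  generalize (extChartAt (𝓡 m).tangent e).symm z = e' at h1 h2
  obtain ⟨x', v⟩ := e'
  change x' = _ at h2
  subst h2
  rw [extChartAt_tangent_apply _ _ (mem_extChartAt_source_symm _ _)] at h1
  refine Prod.ext (coe_extChartAt_symm _ _) ?_
  refine (dIncl_eq_fderiv_sphereParam e.proj z.1 v).trans ?_
  exact congrArg (fderiv ℝ (sphereParam e.proj) z.1) (congrArg Prod.snd h1)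

end TangentBundleChart

/-! ### The Cheeger-Gromoll metric as a pull-back -/

section CheegerGromoll

variable {m : ℕ}

theorem range_tangent_model : Set.range (𝓡 m).tangent = Set.univ := by
  simp [ModelWithCorners.tangent]

theorem dProj_eq_fst (e : TangentBundle (𝓡 m) (Sph m)) :
    dProj (𝓡 m) e = ContinuousLinearMap.fst ℝ _ _ := by
  have hd : MDifferentiableAt (𝓡 m).tangent (𝓡 m)
      (fun e' : TangentBundle (𝓡 m) (Sph m) => e'.proj) e :=
    (Bundle.contMDiff_proj (n := 1) (IB := 𝓡 m) (F := EuclideanSpace ℝ (Fin m))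
      (TangentSpace (𝓡 m) : Sph m → Type _)).mdifferentiable (by norm_num) e
  have hw : writtenInExtChartAt (𝓡 m).tangent (𝓡 m) e
      (fun e' : TangentBundle (𝓡 m) (Sph m) => e'.proj) = Prod.fst := by
    ext1 z
    exact (extChartAt (𝓡 m) e.proj).right_inv (mem_extChartAt_target_sphere _ _)
  unfold dProj
  rw [hd.mfderiv, hw, range_tangent_model, fderivWithin_univ]
  exact fderiv_fst

/-- The correction Γ(u, e) disappears at the centre of the preferred chart. -/
theorem connectionMap_eq_snd (e : TangentBundle (𝓡 m) (Sph m)) :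
    connectionMap (𝓡 m) (roundMetric m) e = ContinuousLinearMap.snd ℝ _ _ := by
  unfold connectionMap
  rw [extChartAt_self_sphere, christoffel_zero]
  refine ContinuousLinearMap.ext fun A => ?_
  change A.2 + 0 = A.2
  rw [add_zero]

theorem bundleParam_zero (x : Sph m) (w : EuclideanSpace ℝ (Fin m)) :
    bundleParam x (0, w) = (↑x, tangentIsometry x w) := by
  simp [bundleParam, sphereParam]

theorem bundleIncl_eq (e : TangentBundle (𝓡 m) (Sph m)) :
    bundleIncl e = bundleParam e.proj (0, e.snd) := by
  refine Eq.trans ?_ (bundleParam_zero e.proj e.snd).symm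
  refine Prod.ext rfl ?_
  change dIncl m e.proj e.snd = _
  rw [dIncl_eq]
  rfl

/-- The second component of the velocity is ιA₂ - ⟪A₁, w⟫x with ι = `tangentIsometry x`. The term -α
⊗ α of the form removes its normal part and leaves A₂, which is KA. -/
theorem ambientForm_bundleParam_zero (p q : ℝ) (x : Sph m) (w : EuclideanSpace ℝ (Fin m))
    (A B : EuclideanSpace ℝ (Fin m) × EuclideanSpace ℝ (Fin m)) :
    ambientForm p q (bundleParam x (0, w)) (fderiv ℝ (bundleParam x) (0, w) A)
        (fderiv ℝ (bundleParam x) (0, w) B) =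
      ⟪A.1, B.1⟫ + (1 + ‖w‖ ^ 2)⁻¹ ^ p * (⟪A.2, B.2⟫ + q * (⟪A.2, w⟫ * ⟪B.2, w⟫)) := by
  have hxx : ⟪(x : Ambient m), x⟫ = 1 := by
    rw [real_inner_self_eq_norm_sq, norm_coe_sphere]
    norm_num
  simp only [ambientForm_apply, bundleParam_zero, fderiv_bundleParam_zero, inner_sub_left,
    inner_sub_right, real_inner_smul_left, real_inner_smul_right, inner_tangentIsometry,
    tangentIsometry_inner, hxx, LinearIsometry.inner_map_map, LinearIsometry.norm_map]
  rw [real_inner_comm w A.2, real_inner_comm w B.2]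
  ring

theorem cheegerGromoll_eq_ambientForm (p q : ℝ) (e : TangentBundle (𝓡 m) (Sph m))
    (A B : EuclideanSpace ℝ (Fin m) × EuclideanSpace ℝ (Fin m)) :
    cheegerGromoll (𝓡 m) (roundMetric m) p q e A B =
      ambientForm p q (bundleIncl e) (fderiv ℝ (bundleParam e.proj) (0, e.snd) A)
        (fderiv ℝ (bundleParam e.proj) (0, e.snd) B) := by
  obtain ⟨x, w⟩ := e
  change EuclideanSpace ℝ (Fin m) at w
  rw [cheegerGromoll_apply, dProj_eq_fst, connectionMap_eq_snd, bundleIncl_eq]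
  change MetricTensor.at (𝓡 m) (roundMetric m) x A.1 B.1
    + (1 + MetricTensor.at (𝓡 m) (roundMetric m) x w w)⁻¹ ^ p *
      (MetricTensor.at (𝓡 m) (roundMetric m) x A.2 B.2
        + q * (MetricTensor.at (𝓡 m) (roundMetric m) x A.2 w
          * MetricTensor.at (𝓡 m) (roundMetric m) x B.2 w)) = _
  simp only [roundMetric_at_apply]
  rw [ambientForm_bundleParam_zero, real_inner_self_eq_norm_sq]

theorem mdifferentiableAt_bundleIncl (e : TangentBundle (𝓡 m) (Sph m)) :
    MDifferentiableAt (𝓡 m).tangent 𝓘(ℝ, Ambient m × Ambient m) bundleIncl e := by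
  have h1 : MDifferentiableAt 𝓘(ℝ, EuclideanSpace ℝ (Fin m) × EuclideanSpace ℝ (Fin m))
      𝓘(ℝ, Ambient m × Ambient m) (bundleParam e.proj) (extChartAt (𝓡 m).tangent e e) :=
    ((contDiff_bundleParam e.proj (n := 1)).differentiable (by norm_num) _).mdifferentiableAt
  have h2 : MDifferentiableAt (𝓡 m).tangent
      𝓘(ℝ, EuclideanSpace ℝ (Fin m) × EuclideanSpace ℝ (Fin m)) (extChartAt (𝓡 m).tangent e) e :=
    mdifferentiableAt_extChartAt (mem_chart_source _ e)
  refine (h1.comp e h2).congr_of_eventuallyEq ?_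
  filter_upwards [extChartAt_source_mem_nhds (I := (𝓡 m).tangent) e] with e' he'
  rw [Function.comp_apply, ← bundleIncl_extChartAt_symm,
    (extChartAt (𝓡 m).tangent e).left_inv he']

theorem mfderiv_bundleIncl (e : TangentBundle (𝓡 m) (Sph m)) :
    mfderiv (𝓡 m).tangent 𝓘(ℝ, Ambient m × Ambient m) bundleIncl e =
      fderiv ℝ (bundleParam e.proj) (0, e.snd) := by
  have hw : writtenInExtChartAt (𝓡 m).tangent 𝓘(ℝ, Ambient m × Ambient m) e bundleIncl
      = bundleParam e.proj := funext (bundleIncl_extChartAt_symm e)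
  rw [(mdifferentiableAt_bundleIncl e).mfderiv, hw, range_tangent_model, fderivWithin_univ,
    extChartAt_tangent_self]

/-- Both parametrisations describe the same embedding, one in the fixed chart at `e`, the other in
the preferred chart at the current point; the chain rule compares them. -/
theorem fderiv_bundleParam_eq (e : TangentBundle (𝓡 m) (Sph m))
    (z A : EuclideanSpace ℝ (Fin m) × EuclideanSpace ℝ (Fin m)) :
    fderiv ℝ (bundleParam e.proj) z A =
      fderiv ℝ (bundleParam ((extChartAt (𝓡 m).tangent e).symm z).proj)
        (0, ((extChartAt (𝓡 m).tangent e).symm z).snd)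
        (mfderiv 𝓘(ℝ, EuclideanSpace ℝ (Fin m) × EuclideanSpace ℝ (Fin m)) (𝓡 m).tangent
          (extChartAt (𝓡 m).tangent e).symm z A) := by
  have hs : MDifferentiableAt 𝓘(ℝ, EuclideanSpace ℝ (Fin m) × EuclideanSpace ℝ (Fin m))
      (𝓡 m).tangent (extChartAt (𝓡 m).tangent e).symm z := by
    have h := mdifferentiableWithinAt_extChartAt_symm (I := (𝓡 m).tangent) (x := e) (z := z)
      (mem_extChartAt_target_tangent e z)
    rwa [range_tangent_model, mdifferentiableWithinAt_univ] at h
  have hc : (fun z => bundleIncl ((extChartAt (𝓡 m).tangent e).symm z)) = bundleParam e.proj :=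
    funext (bundleIncl_extChartAt_symm e)
  have h := mfderiv_comp_apply z
    (mdifferentiableAt_bundleIncl ((extChartAt (𝓡 m).tangent e).symm z)) hs A
  rw [← mfderiv_eq_fderiv, ← hc]
  refine h.trans ?_
  rw [mfderiv_bundleIncl]
  rfl

/-- The identity is needed at every z, not only at the centre, because the Christoffel symbols
differentiate it. -/
theorem chartMetric_cheegerGromoll (p q : ℝ) (e : TangentBundle (𝓡 m) (Sph m)) :
    chartMetric (𝓡 m).tangent (cheegerGromoll (𝓡 m) (roundMetric m) p q) e =
      fun z => (ambientForm p q (bundleParam e.proj z)).bilinearComp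
        (fderiv ℝ (bundleParam e.proj) z) (fderiv ℝ (bundleParam e.proj) z) := by
  funext z
  refine ContinuousLinearMap.ext fun A => ContinuousLinearMap.ext fun B => ?_
  refine (cheegerGromoll_eq_ambientForm p q ((extChartAt (𝓡 m).tangent e).symm z) _ _).trans ?_
  rw [ContinuousLinearMap.bilinearComp_apply, fderiv_bundleParam_eq e z A,
    fderiv_bundleParam_eq e z B, ← bundleIncl_extChartAt_symm]
  rfl

end CheegerGromoll

/-! ### Second fundamental form where the Christoffel symbols of the source vanish -/

section General

variable {E : Type*} [NormedAddCommGroup E] [NormedSpace ℝ E]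
  {H : Type*} [TopologicalSpace H] {I : ModelWithCorners ℝ E H}
  {M : Type*} [TopologicalSpace M] [ChartedSpace H M]
  {E' : Type*} [NormedAddCommGroup E'] [NormedSpace ℝ E']
  {H' : Type*} [TopologicalSpace H'] {I' : ModelWithCorners ℝ E' H'}
  {M' : Type*} [TopologicalSpace M'] [ChartedSpace H' M']

theorem secondFundamentalForm_eq {g : MetricTensor I M} {h : MetricTensor I' M'} {φ : M → M'}
    {x : M} {f : E → E'} {y : E} (hf : writtenInExtChartAt I I' x φ = f) (hy : extChartAt I x x = y)
    (hΓ : christoffel I g x y = 0) (u v : E) :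
    secondFundamentalForm I I' g h φ x u v = (fderiv ℝ (fderiv ℝ f) y u v
      + christoffel I' h (φ x) (f y) (fderiv ℝ f y u) (fderiv ℝ f y v) : E') := by
  unfold secondFundamentalForm
  subst hf
  subst hy
  simp only [hΓ, zero_apply, map_zero, sub_zero]
  rfl

theorem chartMetric_christoffel [FiniteDimensional ℝ E] {g : MetricTensor I M} {x : M} {y : E}
    (hg : ∀ v, chartMetric I g x y v v = 0 → v = 0) (u v w : E) :
    chartMetric I g x y (christoffel I g x y u v) w
      = christoffelFirst (chartMetric I g x) y u v w := by
  rw [christoffel_apply, inverse_apply_of_definite _ hg]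

end General

/-! ### Second-order chain rule -/

section SecondDerivatives

variable {A B C : Type*} [NormedAddCommGroup A] [NormedSpace ℝ A]
  [NormedAddCommGroup B] [NormedSpace ℝ B] [NormedAddCommGroup C] [NormedSpace ℝ C]

theorem fderiv_fderiv_apply {f : A → B} (hf : ContDiff ℝ 2 f) (y u v : A) :
    fderiv ℝ (fun y => fderiv ℝ f y v) y u = fderiv ℝ (fderiv ℝ f) y u v := by
  have hd : DifferentiableAt ℝ (fderiv ℝ f) y :=
    (hf.fderiv_right (m := 1) (by norm_num)).differentiable (by norm_num) y
  rw [fderiv_clm_apply hd (by fun_prop)]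
  simp

theorem fderiv_fderiv_comp {g : B → C} {f : A → B} (hg : ContDiff ℝ 2 g) (hf : ContDiff ℝ 2 f)
    (y u v : A) :
    fderiv ℝ (fderiv ℝ fun y => g (f y)) y u v =
      fderiv ℝ (fderiv ℝ g) (f y) (fderiv ℝ f y u) (fderiv ℝ f y v)
        + fderiv ℝ g (f y) (fderiv ℝ (fderiv ℝ f) y u v) := by
  have hg1 := hg.differentiable (by norm_num)
  have hf1 := hf.differentiable (by norm_num)
  have hg2 : Differentiable ℝ (fderiv ℝ g) :=
    (hg.fderiv_right (m := 1) (by norm_num)).differentiable (by norm_num)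
  have hf2 : Differentiable ℝ (fderiv ℝ f) :=
    (hf.fderiv_right (m := 1) (by norm_num)).differentiable (by norm_num)
  have hgf : ContDiff ℝ 2 fun y => g (f y) := hg.comp hf
  rw [← fderiv_fderiv_apply hgf]
  have h1 : (fun y => fderiv ℝ (fun y => g (f y)) y v)
      = fun y => fderiv ℝ g (f y) (fderiv ℝ f y v) := by
    funext y
    have h : fderiv ℝ (fun y => g (f y)) y = _ := fderiv_comp y (hg1 (f y)) (hf1 y)
    rw [h]
    rfl
  have h2 : fderiv ℝ (fun y => fderiv ℝ g (f y)) y = (fderiv ℝ (fderiv ℝ g) (f y)).comp (fderiv ℝ f y) :=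
    fderiv_comp y (hg2 (f y)) (hf1 y)
  have h3 : DifferentiableAt ℝ (fun y => fderiv ℝ g (f y)) y := (hg2 (f y)).comp y (hf1 y)
  have h4 : DifferentiableAt ℝ (fun y => fderiv ℝ f y v) y := (hf2 y).clm_apply (by fun_prop)
  rw [h1, fderiv_clm_apply h3 h4, h2]
  simp only [add_apply, ContinuousLinearMap.comp_apply, ContinuousLinearMap.flip_apply,
    fderiv_fderiv_apply hf]
  rw [add_comm]

theorem fderiv_fderiv_prodMk {f : A → B} {g : A → C} (hf : ContDiff ℝ 2 f) (hg : ContDiff ℝ 2 g)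
    (y u v : A) :
    fderiv ℝ (fderiv ℝ fun y => (f y, g y)) y u v
      = (fderiv ℝ (fderiv ℝ f) y u v, fderiv ℝ (fderiv ℝ g) y u v) := by
  rw [← fderiv_fderiv_apply (hf.prodMk hg), ← fderiv_fderiv_apply hf, ← fderiv_fderiv_apply hg]
  have h1 : (fun y => fderiv ℝ (fun y => (f y, g y)) y v)
      = fun y => (fderiv ℝ f y v, fderiv ℝ g y v) := by
    funext y
    rw [(hf.differentiable (by norm_num) y).fderiv_prodMk (hg.differentiable (by norm_num) y)]
    rfl
  have hf2 : Differentiable ℝ (fderiv ℝ f) :=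
    (hf.fderiv_right (m := 1) (by norm_num)).differentiable (by norm_num)
  have hg2 : Differentiable ℝ (fderiv ℝ g) :=
    (hg.fderiv_right (m := 1) (by norm_num)).differentiable (by norm_num)
  have h4 : DifferentiableAt ℝ (fun y => fderiv ℝ f y v) y := (hf2 y).clm_apply (by fun_prop)
  have h5 : DifferentiableAt ℝ (fun y => fderiv ℝ g y v) y := (hg2 y).clm_apply (by fun_prop)
  rw [h1, h4.fderiv_prodMk h5]
  rfl

end SecondDerivatives

/-! ### Vector fields on the sphere as maps to the tangent bundle -/

section Sections

variable {m : ℕ} (σ : ∀ x : Sph m, TangentSpace (𝓡 m) x)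

/-- The vector field `σ` in the preferred chart at `x`, with values in the ambient space. -/
def ambientField (x : Sph m) (y : EuclideanSpace ℝ (Fin m)) : Ambient m :=
  fderiv ℝ (sphereParam x) y (chartField (𝓡 m) σ x y)

theorem ambientField_eq (x : Sph m) (y : EuclideanSpace ℝ (Fin m)) :
    ambientField σ x y =
      dIncl m ((extChartAt (𝓡 m) x).symm y) (σ ((extChartAt (𝓡 m) x).symm y)) :=
  (dIncl_eq_fderiv_sphereParam x y _).symm

theorem chartField_zero (x : Sph m) : chartField (𝓡 m) σ x 0 = σ x := by
  -- The type of `σ x'` depends on the base point, so the point is made a variable before the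
  -- equation is substituted.
  have h : ∀ x' : Sph m, x' = x →
      (mfderiv (𝓡 m) 𝓘(ℝ, EuclideanSpace ℝ (Fin m)) (extChartAt (𝓡 m) x) x' (σ x') :
        EuclideanSpace ℝ (Fin m)) = σ x := by
    rintro x' rfl
    rw [mfderiv_extChartAt_self]
    rfl
  exact h _ (extChartAt_symm_zero x)

theorem ambientField_zero (x : Sph m) : ambientField σ x 0 = tangentIsometry x (σ x) := by
  unfold ambientField
  rw [chartField_zero]
  exact fderiv_stereoParam_zero _ _ _

theorem writtenInExtChartAt_toMap (x : Sph m) :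
    writtenInExtChartAt (𝓡 m) (𝓡 m).tangent x (toMap (𝓡 m) σ) =
      fun y => (y, chartField (𝓡 m) σ x y) := by
  funext y
  have h1 := extChartAt_tangent_apply (toMap (𝓡 m) σ x)
    (toMap (𝓡 m) σ ((extChartAt (𝓡 m) x).symm y)) (mem_extChartAt_source_symm x y)
  have h2 : extChartAt (𝓡 m) x ((extChartAt (𝓡 m) x).symm y) = y :=
    (extChartAt (𝓡 m) x).right_inv (mem_extChartAt_target_sphere x y)
  have h3 : extChartAt (𝓡 m).tangent (toMap (𝓡 m) σ x)
      (toMap (𝓡 m) σ ((extChartAt (𝓡 m) x).symm y)) =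
      ((extChartAt (𝓡 m) x ((extChartAt (𝓡 m) x).symm y), chartField (𝓡 m) σ x y) :
        EuclideanSpace ℝ (Fin m) × EuclideanSpace ℝ (Fin m)) := h1
  rw [h2] at h3
  exact h3

variable {σ}

theorem contDiff_chartField (hσ : ContMDiff (𝓡 m) (𝓡 m).tangent ∞ (toMap (𝓡 m) σ)) (x : Sph m) :
    ContDiff ℝ ∞ (chartField (𝓡 m) σ x) := by
  have h1 : ContMDiffOn 𝓘(ℝ, EuclideanSpace ℝ (Fin m)) (𝓡 m) ∞ (extChartAt (𝓡 m) x).symm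
      Set.univ := by
    have h := contMDiffOn_extChartAt_symm (I := 𝓡 m) (n := ∞) x
    rwa [extChartAt_target_sphere] at h
  have h2 : ContMDiffOn (𝓡 m).tangent 𝓘(ℝ, EuclideanSpace ℝ (Fin m) × EuclideanSpace ℝ (Fin m)) ∞
      (extChartAt (𝓡 m).tangent (toMap (𝓡 m) σ x)) _ :=
    contMDiffOn_extChartAt (I := (𝓡 m).tangent) (n := ∞) (x := toMap (𝓡 m) σ x)
  have h3 := h2.comp ((contMDiffOn_univ.2 hσ).comp h1 (fun _ _ => trivial)) (fun y _ => by
    rw [Set.mem_preimage, TangentBundle.mem_chart_source_iff]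
    exact mem_extChartAt_source_symm x y)
  have h4 : ContDiff ℝ ∞ (fun y => (y, chartField (𝓡 m) σ x y)) := by
    rw [← writtenInExtChartAt_toMap]
    exact contMDiff_iff_contDiff.1 (contMDiffOn_univ.1 h3)
  exact h4.snd

theorem contDiff_ambientField (hσ : ContMDiff (𝓡 m) (𝓡 m).tangent ∞ (toMap (𝓡 m) σ))
    (x : Sph m) : ContDiff ℝ ∞ (ambientField σ x) :=
  ((contDiff_sphereParam x (n := ∞)).fderiv_right (by norm_num)).clm_apply
    (contDiff_chartField hσ x)

theorem chartMetric_cheegerGromoll_zero (p q : ℝ) (e : TangentBundle (𝓡 m) (Sph m))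
    (w : EuclideanSpace ℝ (Fin m))
    (A B : EuclideanSpace ℝ (Fin m) × EuclideanSpace ℝ (Fin m)) :
    chartMetric (𝓡 m).tangent (cheegerGromoll (𝓡 m) (roundMetric m) p q) e (0, w) A B =
      ⟪A.1, B.1⟫ + (1 + ‖w‖ ^ 2)⁻¹ ^ p * (⟪A.2, B.2⟫ + q * (⟪A.2, w⟫ * ⟪B.2, w⟫)) := by
  rw [chartMetric_cheegerGromoll]
  exact ambientForm_bundleParam_zero p q e.proj w A B

/-- For q ≥ 0 every term is nonnegative. The fibre over the centre suffices, as the symbols of h are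
evaluated only there. -/
theorem chartMetric_cheegerGromoll_definite (p : ℝ) {q : ℝ} (hq : 0 ≤ q)
    (e : TangentBundle (𝓡 m) (Sph m)) (w : EuclideanSpace ℝ (Fin m))
    (A : EuclideanSpace ℝ (Fin m) × EuclideanSpace ℝ (Fin m))
    (hA : chartMetric (𝓡 m).tangent (cheegerGromoll (𝓡 m) (roundMetric m) p q) e (0, w) A A = 0) :
    A = 0 := by
  rw [chartMetric_cheegerGromoll_zero, real_inner_self_eq_norm_sq, real_inner_self_eq_norm_sq] at hA
  have hω : 0 < (1 + ‖w‖ ^ 2)⁻¹ ^ p := by positivity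
  have h3 : 0 ≤ q * (⟪A.2, w⟫ * ⟪A.2, w⟫) := mul_nonneg hq (mul_self_nonneg _)
  have h1 : ‖A.1‖ ^ 2 = 0 := by
    have := mul_nonneg hω.le (add_nonneg (sq_nonneg ‖A.2‖) h3)
    nlinarith [sq_nonneg ‖A.1‖]
  have h2 : ‖A.2‖ ^ 2 = 0 := by
    rw [h1, zero_add] at hA
    have := (mul_eq_zero.1 hA).resolve_left hω.ne'
    nlinarith [sq_nonneg ‖A.2‖]
  exact Prod.ext (by simpa using h1) (by simpa using h2)

theorem secondFundamentalForm_toMap (p q : ℝ) (x : Sph m) (u v : EuclideanSpace ℝ (Fin m)) :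
    secondFundamentalForm (𝓡 m) (𝓡 m).tangent (roundMetric m)
      (cheegerGromoll (𝓡 m) (roundMetric m) p q) (toMap (𝓡 m) σ) x u v =
    (fderiv ℝ (fderiv ℝ fun y => (y, chartField (𝓡 m) σ x y)) 0 u v
      + christoffel (𝓡 m).tangent (cheegerGromoll (𝓡 m) (roundMetric m) p q) (toMap (𝓡 m) σ x)
        (0, σ x) (fderiv ℝ (fun y => (y, chartField (𝓡 m) σ x y)) 0 u)
        (fderiv ℝ (fun y => (y, chartField (𝓡 m) σ x y)) 0 v) :
        EuclideanSpace ℝ (Fin m) × EuclideanSpace ℝ (Fin m)) := by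
  refine (secondFundamentalForm_eq (writtenInExtChartAt_toMap σ x) (extChartAt_self_sphere x)
    (christoffel_zero x) u v).trans ?_
  rw [chartField_zero]

/-- The second fundamental form of a vector field on the sphere, as a map to the tangent bundle,
evaluated by means of the embedding of the tangent bundle in `V × V`. -/
theorem inner_secondFundamentalForm (hσ : ContMDiff (𝓡 m) (𝓡 m).tangent ∞ (toMap (𝓡 m) σ))
    {p q : ℝ} (hq : 0 ≤ q) (x : Sph m) (u v : EuclideanSpace ℝ (Fin m))
    (w : EuclideanSpace ℝ (Fin m)) (hw : w = σ x)
    (A B : EuclideanSpace ℝ (Fin m) × EuclideanSpace ℝ (Fin m))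
    (hA : A = secondFundamentalForm (𝓡 m) (𝓡 m).tangent (roundMetric m)
      (cheegerGromoll (𝓡 m) (roundMetric m) p q) (toMap (𝓡 m) σ) x u v) :
    ⟪A.1, B.1⟫ + (1 + ‖w‖ ^ 2)⁻¹ ^ p * (⟪A.2, B.2⟫ + q * (⟪A.2, w⟫ * ⟪B.2, w⟫)) =
      ambientForm p q (↑x, tangentIsometry x w)
        (-⟪u, v⟫ • ↑x, fderiv ℝ (fderiv ℝ (ambientField σ x)) 0 u v)
        (tangentIsometry x B.1, tangentIsometry x B.2 - ⟪B.1, w⟫ • ↑x)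
      + christoffelFirst (ambientForm p q) (↑x, tangentIsometry x w)
        (tangentIsometry x u, fderiv ℝ (ambientField σ x) 0 u)
        (tangentIsometry x v, fderiv ℝ (ambientField σ x) 0 v)
        (tangentIsometry x B.1, tangentIsometry x B.2 - ⟪B.1, w⟫ • ↑x) := by
  have hs : ContDiff ℝ ∞ (chartField (𝓡 m) σ x) := contDiff_chartField hσ x
  rw [secondFundamentalForm_toMap, ← hw] at hA
  have hf0 : chartField (𝓡 m) σ x 0 = w := by
    rw [hw, chartField_zero]
  have hfs : ContDiff ℝ 2 fun y => (y, chartField (𝓡 m) σ x y) :=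
    contDiff_id.prodMk (hs.of_le (by norm_cast))
  have hS : ContDiff ℝ 2 (ambientField σ x) :=
    (contDiff_ambientField hσ x).of_le (by norm_cast)
  -- Embedding the chart expression of σ gives (F, S), so both of its derivatives can be compared
  -- with those of F and S.
  have hP : (fun y => bundleParam x (y, chartField (𝓡 m) σ x y))
      = fun y => (sphereParam x y, ambientField σ x y) := rfl
  have hΨ : ContDiff ℝ 2 (bundleParam x) := contDiff_bundleParam x (n := 2)
  have hD1 : ∀ u, fderiv ℝ (bundleParam x) (0, w)
      (fderiv ℝ (fun y => (y, chartField (𝓡 m) σ x y)) 0 u)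
      = (tangentIsometry x u, fderiv ℝ (ambientField σ x) 0 u) := by
    intro u
    have h1 : fderiv ℝ (fun y => bundleParam x (y, chartField (𝓡 m) σ x y)) 0 = _ :=
      fderiv_comp 0 (hΨ.differentiable (by norm_num) _) (hfs.differentiable (by norm_num) 0)
    rw [hP, (differentiable_sphereParam x 0).fderiv_prodMk (hS.differentiable (by norm_num) 0),
      hf0] at h1
    have h2 : fderiv ℝ (sphereParam x) 0 u = tangentIsometry x u := fderiv_stereoParam_zero _ _ u
    rw [← h2]
    exact (congrArg (fun L => L u) h1).symm
  have hD2 := fderiv_fderiv_comp hΨ hfs 0 u v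
  rw [hP, fderiv_fderiv_prodMk (contDiff_sphereParam x) hS, hf0] at hD2
  have hF2 : fderiv ℝ (fderiv ℝ (sphereParam x)) 0 u v = -⟪u, v⟫ • (x : Ambient m) :=
    fderiv_fderiv_stereoParam_zero _ _ u v
  rw [hF2] at hD2
  rw [← chartMetric_cheegerGromoll_zero p q (toMap (𝓡 m) σ x), hA, map_add, add_apply,
    chartMetric_christoffel (chartMetric_cheegerGromoll_definite p hq _ w),
    chartMetric_cheegerGromoll]
  have hpull := christoffelFirst_pullback (z := (0, w))
    (k := (ambientForm p q : Ambient m × Ambient m → _)) (Ψ := bundleParam x)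
    ((contDiff_ambientForm p q).differentiable (by norm_num) _)
    (fun a b => ambientForm_symm p q _ a b) hΨ.contDiffAt
    (fderiv ℝ (fun y => (y, chartField (𝓡 m) σ x y)) 0 u)
    (fderiv ℝ (fun y => (y, chartField (𝓡 m) σ x y)) 0 v) B
  have hadd : ∀ a b c : Ambient m × Ambient m,
      ambientForm p q (bundleParam x (0, w)) a c + ambientForm p q (bundleParam x (0, w)) b c
        = ambientForm p q (bundleParam x (0, w)) (b + a) c := by
    intro a b c
    rw [map_add, add_apply, add_comm]
  refine (congrArg₂ (· + ·) rfl hpull).trans ?_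
  -- By `hD2` the Hessian of the chart expression and the D²Ψ term of the pull-back formula add up
  -- to the second derivative of (F, S).
  rw [← bundleParam_zero, ← fderiv_bundleParam_zero, hD2, ← hD1, ← hD1, ← hadd, add_assoc]
  rfl

end Sections

/-! ### The tension field of a Killing field of constant norm -/

section Tension

variable {m : ℕ} {σ : ∀ x : Sph m, TangentSpace (𝓡 m) x}

/-- Differentiate ⟪F, S⟫ = 0, which says that S is tangent. -/
theorem inner_fderiv_ambientField_base
    (hσ : ContMDiff (𝓡 m) (𝓡 m).tangent ∞ (toMap (𝓡 m) σ)) (x : Sph m)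
    (u w : EuclideanSpace ℝ (Fin m)) (hw : w = σ x) :
    ⟪(x : Ambient m), fderiv ℝ (ambientField σ x) 0 u⟫ = -⟪u, w⟫ := by
  have h1 : (fun y => ⟪sphereParam x y, ambientField σ x y⟫) = fun _ => (0 : ℝ) :=
    funext fun y => inner_stereoParam_fderiv (norm_coe_sphere x) (inner_tangentIsometry x) y _
  have h2 := fderiv_inner_apply ℝ (differentiable_sphereParam x 0)
    ((contDiff_ambientField hσ x).differentiable (by norm_num) 0) u
  rw [h1] at h2
  have h3 : fderiv ℝ (sphereParam x) 0 u = tangentIsometry x u := fderiv_stereoParam_zero _ _ u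
  have h4 : sphereParam x 0 = x := stereoParam_zero _ _
  rw [h3, h4, ambientField_zero, ← hw, LinearIsometry.inner_map_map] at h2
  simp only [fderiv_fun_const, Pi.zero_apply, zero_apply] at h2
  linarith

theorem inner_ambientField_self (x : Sph m) (y : EuclideanSpace ℝ (Fin m)) :
    ⟪ambientField σ x y, ambientField σ x y⟫
      = normSq (𝓡 m) (roundMetric m) σ ((extChartAt (𝓡 m) x).symm y) := by
  rw [ambientField_eq]
  rfl

theorem inner_ambientField_fderiv
    (hσ : ContMDiff (𝓡 m) (𝓡 m).tangent ∞ (toMap (𝓡 m) σ)) {c : ℝ}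
    (hc : ∀ x, normSq (𝓡 m) (roundMetric m) σ x = c) (x : Sph m)
    (y u : EuclideanSpace ℝ (Fin m)) :
    ⟪ambientField σ x y, fderiv ℝ (ambientField σ x) y u⟫ = 0 := by
  have h1 : (fun y => ⟪ambientField σ x y, ambientField σ x y⟫) = fun _ => c :=
    funext fun y => (inner_ambientField_self x y).trans (hc _)
  have hd := (contDiff_ambientField hσ x).differentiable (by norm_num) y
  have h2 := fderiv_inner_apply ℝ hd hd u
  rw [h1] at h2
  simp only [fderiv_fun_const, Pi.zero_apply, zero_apply] at h2
  rw [real_inner_comm (ambientField σ x y)] at h2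
  linarith

theorem inner_ambientField_fderiv_fderiv
    (hσ : ContMDiff (𝓡 m) (𝓡 m).tangent ∞ (toMap (𝓡 m) σ)) {c : ℝ}
    (hc : ∀ x, normSq (𝓡 m) (roundMetric m) σ x = c) (x : Sph m)
    (y u v : EuclideanSpace ℝ (Fin m)) :
    ⟪ambientField σ x y, fderiv ℝ (fderiv ℝ (ambientField σ x)) y u v⟫
      = -⟪fderiv ℝ (ambientField σ x) y u, fderiv ℝ (ambientField σ x) y v⟫ := by
  have hS : ContDiff ℝ 2 (ambientField σ x) := (contDiff_ambientField hσ x).of_le (by norm_cast)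
  have h1 : (fun y => ⟪ambientField σ x y, fderiv ℝ (ambientField σ x) y v⟫) = fun _ => (0 : ℝ) :=
    funext fun y => inner_ambientField_fderiv hσ hc x y v
  have hd := hS.differentiable (by norm_num) y
  have hd2 : DifferentiableAt ℝ (fun y => fderiv ℝ (ambientField σ x) y v) y :=
    ((hS.fderiv_right (m := 1) (by norm_num)).differentiable (by norm_num) y).clm_apply (by fun_prop)
  have h2 := fderiv_inner_apply ℝ hd hd2 u
  rw [h1, fderiv_fderiv_apply hS] at h2
  simp only [fderiv_fun_const, Pi.zero_apply, zero_apply] at h2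
  linarith

/-- Constant norm makes D_uS orthogonal to σ, and Killing's equation with v = u makes it orthogonal
to u. By constant norm the q-term of D²S is -q|D_uS|²⟪w, B₂⟫, which cancels that of the Christoffel
part. The difference |D_uS|² - ⟪u, w⟫² is |∇_uσ|². -/
theorem inner_secondFundamentalForm_self
    (hσ : ContMDiff (𝓡 m) (𝓡 m).tangent ∞ (toMap (𝓡 m) σ))
    {c : ℝ} (hc : ∀ x, normSq (𝓡 m) (roundMetric m) σ x = c)
    {p q : ℝ} (hq : 0 ≤ q) (x : Sph m)
    (hK : ∀ u v, ⟪fderiv ℝ (ambientField σ x) 0 u, tangentIsometry x v⟫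
      + ⟪tangentIsometry x u, fderiv ℝ (ambientField σ x) 0 v⟫ = 0)
    (u w : EuclideanSpace ℝ (Fin m)) (hw : w = σ x)
    (A B : EuclideanSpace ℝ (Fin m) × EuclideanSpace ℝ (Fin m))
    (hA : A = secondFundamentalForm (𝓡 m) (𝓡 m).tangent (roundMetric m)
      (cheegerGromoll (𝓡 m) (roundMetric m) p q) (toMap (𝓡 m) σ) x u u) :
    ⟪A.1, B.1⟫ + (1 + ‖w‖ ^ 2)⁻¹ ^ p * (⟪A.2, B.2⟫ + q * (⟪A.2, w⟫ * ⟪B.2, w⟫)) =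
      (1 + ‖w‖ ^ 2)⁻¹ ^ p *
        (⟪fderiv ℝ (fderiv ℝ (ambientField σ x)) 0 u u, tangentIsometry x B.2⟫ + ⟪u, w⟫ * ⟪u, B.2⟫
          + p * (1 + ‖w‖ ^ 2)⁻¹ * ⟪w, B.2⟫ *
            (⟪fderiv ℝ (ambientField σ x) 0 u, fderiv ℝ (ambientField σ x) 0 u⟫ - ⟪u, w⟫ ^ 2)
          - ⟪tangentIsometry x B.1, fderiv ℝ (ambientField σ x) 0 u⟫ * ⟪u, w⟫) := by
  rw [inner_secondFundamentalForm hσ hq x u u w hw A B hA]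
  have hxx : ⟪(x : Ambient m), x⟫ = 1 := by
    rw [real_inner_self_eq_norm_sq, norm_coe_sphere]
    norm_num
  have h0 : ambientField σ x 0 = tangentIsometry x w := by rw [ambientField_zero, hw]
  have h1 := inner_fderiv_ambientField_base hσ x u w hw
  have h2 := inner_ambientField_fderiv hσ hc x 0 u
  have h3 := inner_ambientField_fderiv_fderiv hσ hc x 0 u u
  have h4 : ⟪tangentIsometry x u, fderiv ℝ (ambientField σ x) 0 u⟫ = 0 := by
    have := hK u u
    rw [real_inner_comm] at this
    linarith
  rw [h0] at h2 h3
  generalize fderiv ℝ (ambientField σ x) 0 u = S1 at *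
  generalize fderiv ℝ (fderiv ℝ (ambientField σ x)) 0 u u = S2 at *
  have h1' : ⟪S1, (x : Ambient m)⟫ = -⟪u, w⟫ := by rw [real_inner_comm, h1]
  rw [christoffelFirst_apply]
  simp only [fderiv_ambientForm_apply, ambientForm_apply, inner_sub_left,
    inner_sub_right, real_inner_smul_left, real_inner_smul_right, inner_tangentIsometry,
    tangentIsometry_inner, hxx, LinearIsometry.inner_map_map, LinearIsometry.norm_map,
    h1, h2, h3, h4, h1']
  rw [real_inner_comm S1 (tangentIsometry x B.1), real_inner_comm S2 (x : Ambient m)]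
  ring

theorem tensionField_toMap (p q : ℝ) (x : Sph m)
    {ι : Type*} [Fintype ι] (e : OrthonormalBasis ι ℝ (EuclideanSpace ℝ (Fin m))) :
    tensionField (𝓡 m) (𝓡 m).tangent (roundMetric m)
      (cheegerGromoll (𝓡 m) (roundMetric m) p q) (toMap (𝓡 m) σ) x =
    (∑ i, (secondFundamentalForm (𝓡 m) (𝓡 m).tangent (roundMetric m)
      (cheegerGromoll (𝓡 m) (roundMetric m) p q) (toMap (𝓡 m) σ) x (e i) (e i) :
        EuclideanSpace ℝ (Fin m) × EuclideanSpace ℝ (Fin m)) :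
        EuclideanSpace ℝ (Fin m) × EuclideanSpace ℝ (Fin m)) := by
  set f := fun y => (y, chartField (𝓡 m) σ x y) with hf
  -- This exhibits the bilinearity needed to pass to an orthonormal basis.
  let B : EuclideanSpace ℝ (Fin m) →L[ℝ] EuclideanSpace ℝ (Fin m) →L[ℝ]
      EuclideanSpace ℝ (Fin m) × EuclideanSpace ℝ (Fin m) :=
    fderiv ℝ (fderiv ℝ f) 0 + (christoffel (𝓡 m).tangent (cheegerGromoll (𝓡 m) (roundMetric m) p q)
      (toMap (𝓡 m) σ x) (0, σ x)).bilinearComp (fderiv ℝ f 0) (fderiv ℝ f 0)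
  exact metricTrace_eq_sum (F := EuclideanSpace ℝ (Fin m) × EuclideanSpace ℝ (Fin m))
    (MetricTensor.at (𝓡 m) (roundMetric m) x) (roundMetric_at_apply x)
    (secondFundamentalForm (𝓡 m) (𝓡 m).tangent (roundMetric m)
      (cheegerGromoll (𝓡 m) (roundMetric m) p q) (toMap (𝓡 m) σ) x) B.toLinearMap₁₂
    (fun u v => secondFundamentalForm_toMap p q x u v) e

theorem inner_tensionField
    (hσ : ContMDiff (𝓡 m) (𝓡 m).tangent ∞ (toMap (𝓡 m) σ))
    {c : ℝ} (hc : ∀ x, normSq (𝓡 m) (roundMetric m) σ x = c)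
    {p q : ℝ} (hq : 0 ≤ q) (x : Sph m)
    (hK : ∀ u v, ⟪fderiv ℝ (ambientField σ x) 0 u, tangentIsometry x v⟫
      + ⟪tangentIsometry x u, fderiv ℝ (ambientField σ x) 0 v⟫ = 0)
    {ι : Type*} [Fintype ι] (e : OrthonormalBasis ι ℝ (EuclideanSpace ℝ (Fin m)))
    (w : EuclideanSpace ℝ (Fin m)) (hw : w = σ x)
    (A B : EuclideanSpace ℝ (Fin m) × EuclideanSpace ℝ (Fin m))
    (hA : A = tensionField (𝓡 m) (𝓡 m).tangent (roundMetric m)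
      (cheegerGromoll (𝓡 m) (roundMetric m) p q) (toMap (𝓡 m) σ) x) :
    ⟪A.1, B.1⟫ + (1 + ‖w‖ ^ 2)⁻¹ ^ p * (⟪A.2, B.2⟫ + q * (⟪A.2, w⟫ * ⟪B.2, w⟫)) =
      (1 + ‖w‖ ^ 2)⁻¹ ^ p *
        (∑ i, ⟪fderiv ℝ (fderiv ℝ (ambientField σ x)) 0 (e i) (e i), tangentIsometry x B.2⟫
          + ⟪w, B.2⟫ + p * (1 + ‖w‖ ^ 2)⁻¹ * ⟪w, B.2⟫ *
            (∑ i, ⟪fderiv ℝ (ambientField σ x) 0 (e i), fderiv ℝ (ambientField σ x) 0 (e i)⟫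
              - ‖w‖ ^ 2)) := by
  have hsum : ∀ u v : EuclideanSpace ℝ (Fin m), ∑ i, ⟪e i, u⟫ * ⟪e i, v⟫ = ⟪u, v⟫ := by
    intro u v
    rw [← e.sum_inner_mul_inner u v]
    exact Finset.sum_congr rfl fun i _ => by rw [real_inner_comm]
  have h0 : ambientField σ x 0 = tangentIsometry x w := by rw [ambientField_zero, hw]
  -- The sum is g(B₁, ∇_σσ). Killing's equation turns it into -g(∇_{B₁}σ, σ), which is zero for
  -- constant norm.
  have hvanish : ∑ i, ⟪tangentIsometry x B.1, fderiv ℝ (ambientField σ x) 0 (e i)⟫ * ⟪e i, w⟫ = 0 := by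
    have h1 := inner_ambientField_fderiv hσ hc x 0 B.1
    have h2 := hK w B.1
    rw [h0] at h1
    rw [h1, add_zero, real_inner_comm] at h2
    rw [← h2]
    conv_rhs => rw [← e.sum_repr' w, map_sum, inner_sum]
    refine Finset.sum_congr rfl fun i _ => ?_
    rw [map_smul, real_inner_smul_right, mul_comm]
  rw [tensionField_toMap p q x e] at hA
  set τ : ι → EuclideanSpace ℝ (Fin m) × EuclideanSpace ℝ (Fin m) := fun i =>
    secondFundamentalForm (𝓡 m) (𝓡 m).tangent (roundMetric m)
      (cheegerGromoll (𝓡 m) (roundMetric m) p q) (toMap (𝓡 m) σ) x (e i) (e i) with hτ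
  have hi := fun i => inner_secondFundamentalForm_self hσ hc hq x hK (e i) w hw (τ i) B rfl
  have hlhs : ⟪A.1, B.1⟫ + (1 + ‖w‖ ^ 2)⁻¹ ^ p * (⟪A.2, B.2⟫ + q * (⟪A.2, w⟫ * ⟪B.2, w⟫))
      = ∑ i, (⟪(τ i).1, B.1⟫ + (1 + ‖w‖ ^ 2)⁻¹ ^ p *
          (⟪(τ i).2, B.2⟫ + q * (⟪(τ i).2, w⟫ * ⟪B.2, w⟫))) := by
    have h1 : A.1 = ∑ i, (τ i).1 := by rw [hA]; exact Prod.fst_sum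
    have h2 : A.2 = ∑ i, (τ i).2 := by rw [hA]; exact Prod.snd_sum
    rw [h1, h2, sum_inner, sum_inner, sum_inner, Finset.sum_mul,
      Finset.mul_sum, ← Finset.sum_add_distrib, Finset.mul_sum, ← Finset.sum_add_distrib]
  rw [hlhs, Finset.sum_congr rfl fun i _ => hi i, ← Finset.mul_sum, Finset.sum_sub_distrib,
    hvanish, Finset.sum_add_distrib, Finset.sum_add_distrib, hsum, ← Finset.mul_sum,
    Finset.sum_sub_distrib, ← real_inner_self_eq_norm_sq, ← hsum w w, sub_zero]
  simp only [sq]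

/-- The tension field of a vector field of constant norm satisfying Killing's equation is
vertical. -/
theorem fst_tensionField_eq_zero
    (hσ : ContMDiff (𝓡 m) (𝓡 m).tangent ∞ (toMap (𝓡 m) σ))
    {c : ℝ} (hc : ∀ x, normSq (𝓡 m) (roundMetric m) σ x = c)
    {p q : ℝ} (hq : 0 ≤ q) (x : Sph m)
    (hK : ∀ u v, ⟪fderiv ℝ (ambientField σ x) 0 u, tangentIsometry x v⟫
      + ⟪tangentIsometry x u, fderiv ℝ (ambientField σ x) 0 v⟫ = 0) :
    dProj (𝓡 m) (toMap (𝓡 m) σ x) (tensionField (𝓡 m) (𝓡 m).tangent (roundMetric m)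
      (cheegerGromoll (𝓡 m) (roundMetric m) p q) (toMap (𝓡 m) σ) x) = 0 := by
  rw [dProj_eq_fst]
  generalize hA : tensionField (𝓡 m) (𝓡 m).tangent (roundMetric m)
      (cheegerGromoll (𝓡 m) (roundMetric m) p q) (toMap (𝓡 m) σ) x = A
  change EuclideanSpace ℝ (Fin m) × EuclideanSpace ℝ (Fin m) at A
  -- Typing `σ x` as a vector of the model space makes its norm and inner product available.
  obtain ⟨w, hw⟩ : ∃ w : EuclideanSpace ℝ (Fin m), w = σ x := ⟨σ x, rfl⟩
  -- Against a horizontal vector the right-hand side is zero, and the left-hand side is |A₁|².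
  have h := inner_tensionField hσ hc hq x hK (EuclideanSpace.basisFun (Fin m) ℝ) w hw A
    (A.1, 0) hA.symm
  simp only [inner_zero_right, inner_zero_left, map_zero, mul_zero, add_zero, zero_mul,
    Finset.sum_const_zero] at h
  exact inner_self_eq_zero.1 h

theorem tensionField_eq_zero
    (hσ : ContMDiff (𝓡 m) (𝓡 m).tangent ∞ (toMap (𝓡 m) σ))
    {c : ℝ} (hc : ∀ x, normSq (𝓡 m) (roundMetric m) σ x = c)
    {p q : ℝ} (hq : 0 ≤ q) (x : Sph m)
    (hK : ∀ u v, ⟪fderiv ℝ (ambientField σ x) 0 u, tangentIsometry x v⟫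
      + ⟪tangentIsometry x u, fderiv ℝ (ambientField σ x) 0 v⟫ = 0)
    {ι : Type*} [Fintype ι] (e : OrthonormalBasis ι ℝ (EuclideanSpace ℝ (Fin m)))
    (w : EuclideanSpace ℝ (Fin m)) (hw : w = σ x)
    (hE : ∀ d, ∑ i, ⟪fderiv ℝ (fderiv ℝ (ambientField σ x)) 0 (e i) (e i), tangentIsometry x d⟫
          + ⟪w, d⟫ + p * (1 + ‖w‖ ^ 2)⁻¹ * ⟪w, d⟫ *
            (∑ i, ⟪fderiv ℝ (ambientField σ x) 0 (e i), fderiv ℝ (ambientField σ x) 0 (e i)⟫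
              - ‖w‖ ^ 2) = 0) :
    tensionField (𝓡 m) (𝓡 m).tangent (roundMetric m)
      (cheegerGromoll (𝓡 m) (roundMetric m) p q) (toMap (𝓡 m) σ) x = 0 := by
  generalize hA : tensionField (𝓡 m) (𝓡 m).tangent (roundMetric m)
      (cheegerGromoll (𝓡 m) (roundMetric m) p q) (toMap (𝓡 m) σ) x = A
  change EuclideanSpace ℝ (Fin m) × EuclideanSpace ℝ (Fin m) at A
  have h := inner_tensionField hσ hc hq x hK e w hw A A hA.symm
  rw [hE, mul_zero, ← chartMetric_cheegerGromoll_zero p q (toMap (𝓡 m) σ x)] at h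
  exact chartMetric_cheegerGromoll_definite p hq _ w A h

end Tension

/-! ### Differentiating through the conformal factor -/

section ConformalFactor

variable {m : ℕ} {G : Type*} [NormedAddCommGroup G] [InnerProductSpace ℝ G]

/-- Chart expressions defined through an inverse metric or a chosen preimage are known only by their
pairings. Dividing by the conformal factor recovers their coordinates, hence their smoothness. -/
theorem contDiff_of_conformal_inner {n : ℕ∞ω} {f : G → EuclideanSpace ℝ (Fin m)}
    {h : EuclideanSpace ℝ (Fin m) → G → ℝ} (hh : ∀ w, ContDiff ℝ n (h w))
    (hf : ∀ y w, (4 * (‖y‖ ^ 2 + 4)⁻¹) ^ 2 * ⟪f y, w⟫ = h w y) : ContDiff ℝ n f := by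
  rw [contDiff_euclidean]
  intro i
  have h1 : (fun y => f y i)
      = fun y => ((‖y‖ ^ 2 + 4) * 4⁻¹) ^ 2 * h (EuclideanSpace.single i 1) y := by
    funext y
    rw [← hf, EuclideanSpace.inner_single_right]
    have h4 : ‖y‖ ^ 2 + 4 ≠ 0 := by positivity
    field_simp
    simp
  rw [h1]
  exact (((((contDiff_norm_sq ℝ).add contDiff_const)).mul contDiff_const).pow 2).mul (hh _)

/-- At 0 the factor has value 1 and derivative 0. -/
theorem inner_fderiv_zero_of_conformal_inner {f : G → EuclideanSpace ℝ (Fin m)}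
    (hd : DifferentiableAt ℝ f 0) {h : G → ℝ} {w : EuclideanSpace ℝ (Fin m)}
    (hf : ∀ y, (4 * (‖y‖ ^ 2 + 4)⁻¹) ^ 2 * ⟪f y, w⟫ = h y) (u : G) :
    ⟪fderiv ℝ f 0 u, w⟫ = fderiv ℝ h 0 u := by
  have h1 := ((hasFDerivAt_inv_norm_sq (0 : G)).const_mul 4).pow 2
  have h2 : HasFDerivAt (fun y => ⟪f y, w⟫) ((innerSL ℝ w).comp (fderiv ℝ f 0)) 0 := by
    refine ((innerSL ℝ w).hasFDerivAt.comp (0 : G) hd.hasFDerivAt).congr_of_eventuallyEq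
      (Filter.Eventually.of_forall fun y => ?_)
    exact real_inner_comm _ _
  have h3 : HasFDerivAt h _ 0 :=
    (h1.mul h2).congr_of_eventuallyEq (Filter.Eventually.of_forall fun y => (hf y).symm)
  rw [h3.fderiv]
  simp
  rw [real_inner_comm]

end ConformalFactor

/-! ### Covariant derivatives and rough Laplacian via the ambient field -/

section CovariantDerivatives

variable {m : ℕ} {σ : ∀ x : Sph m, TangentSpace (𝓡 m) x}

/-- Gauss formula for vector fields: ∇_vσ is the tangential part of D_vS. -/
theorem inner_fderiv_chartCovDeriv (hσ : ContMDiff (𝓡 m) (𝓡 m).tangent ∞ (toMap (𝓡 m) σ))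
    (x : Sph m) (y v w : EuclideanSpace ℝ (Fin m)) :
    ⟪fderiv ℝ (sphereParam x) y (chartCovDeriv (𝓡 m) (roundMetric m) σ x y v),
      fderiv ℝ (sphereParam x) y w⟫
      = ⟪fderiv ℝ (ambientField σ x) y v, fderiv ℝ (sphereParam x) y w⟫ := by
  have hd : DifferentiableAt ℝ (fderiv ℝ (sphereParam x)) y :=
    ((contDiff_sphereParam x (n := 2)).fderiv_right (m := 1) (by norm_num)).differentiable
      (by norm_num) y
  have hs : DifferentiableAt ℝ (chartField (𝓡 m) σ x) y :=
    (contDiff_chartField hσ x).differentiable (by norm_num) y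
  have h1 : fderiv ℝ (ambientField σ x) y = _ := fderiv_clm_apply hd hs
  rw [h1]
  simp only [chartCovDeriv, map_add, add_apply, ContinuousLinearMap.comp_apply,
    ContinuousLinearMap.flip_apply, inner_add_left]
  rw [inner_fderiv_christoffel]

theorem covDeriv_eq (x : Sph m) (u : EuclideanSpace ℝ (Fin m)) :
    covDeriv (𝓡 m) (roundMetric m) σ x u = fderiv ℝ (chartField (𝓡 m) σ x) 0 u := by
  have h : covDeriv (𝓡 m) (roundMetric m) σ x u =
    chartCovDeriv (𝓡 m) (roundMetric m) σ x (extChartAt (𝓡 m) x x) u := rfl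
  rw [h, extChartAt_self_sphere, chartCovDeriv, christoffel_zero]
  exact add_zero _

theorem inner_fderiv_chartField (hσ : ContMDiff (𝓡 m) (𝓡 m).tangent ∞ (toMap (𝓡 m) σ))
    (x : Sph m) (v w : EuclideanSpace ℝ (Fin m)) :
    ⟪fderiv ℝ (chartField (𝓡 m) σ x) 0 v, w⟫
      = ⟪fderiv ℝ (ambientField σ x) 0 v, tangentIsometry x w⟫ := by
  have h := inner_fderiv_chartCovDeriv hσ x 0 v w
  have h1 : ∀ u, fderiv ℝ (sphereParam x) 0 u = tangentIsometry x u := fderiv_stereoParam_zero _ _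
  rw [h1, h1, LinearIsometry.inner_map_map, chartCovDeriv, christoffel_zero] at h
  rw [← h]
  simp

theorem killing_ambientField (hσ : ContMDiff (𝓡 m) (𝓡 m).tangent ∞ (toMap (𝓡 m) σ))
    (hK : IsKilling (𝓡 m) (roundMetric m) σ) (x : Sph m) (u v : EuclideanSpace ℝ (Fin m)) :
    ⟪fderiv ℝ (ambientField σ x) 0 u, tangentIsometry x v⟫
      + ⟪tangentIsometry x u, fderiv ℝ (ambientField σ x) 0 v⟫ = 0 := by
  have h : MetricTensor.at (𝓡 m) (roundMetric m) x (covDeriv (𝓡 m) (roundMetric m) σ x u) v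
    + MetricTensor.at (𝓡 m) (roundMetric m) x u (covDeriv (𝓡 m) (roundMetric m) σ x v) = 0 := hK x u v
  rw [covDeriv_eq, covDeriv_eq] at h
  replace h :=
    (congrArg₂ (· + ·) (roundMetric_at_apply x _ v) (roundMetric_at_apply x u _)).symm.trans h
  beta_reduce at h
  rw [real_inner_comm _ u, inner_fderiv_chartField hσ, inner_fderiv_chartField hσ,
    real_inner_comm (tangentIsometry x u)] at h
  exact h

theorem inner_fderiv_ambientField (hσ : ContMDiff (𝓡 m) (𝓡 m).tangent ∞ (toMap (𝓡 m) σ))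
    (x : Sph m) (u w : EuclideanSpace ℝ (Fin m)) (hw : w = σ x) :
    ⟪fderiv ℝ (chartField (𝓡 m) σ x) 0 u, fderiv ℝ (chartField (𝓡 m) σ x) 0 u⟫
      = ⟪fderiv ℝ (ambientField σ x) 0 u, fderiv ℝ (ambientField σ x) 0 u⟫ - ⟪u, w⟫ ^ 2 := by
  have h1 := inner_fderiv_ambientField_base hσ x u w hw
  have h2 := inner_fderiv_chartField hσ x u
  generalize fderiv ℝ (chartField (𝓡 m) σ x) 0 u = a at *
  generalize fderiv ℝ (ambientField σ x) 0 u = S1 at *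
  have hxx : ⟪(x : Ambient m), x⟫ = 1 := by
    rw [real_inner_self_eq_norm_sq, norm_coe_sphere]
    norm_num
  -- The normal component of D_uS is -⟪u, w⟫x; adding it back leaves the tangential part, and
  -- Pythagoras concludes.
  obtain ⟨b, hb⟩ := exists_tangentIsometry_eq x (S1 + ⟪u, w⟫ • (x : Ambient m)) (by
    rw [inner_add_right, real_inner_smul_right, h1, hxx]
    ring)
  have hS : S1 = tangentIsometry x b - ⟪u, w⟫ • (x : Ambient m) := by rw [hb]; module
  have hab : a = b := by
    refine ext_inner_right ℝ fun d => ?_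
    rw [h2, hS, inner_sub_left, real_inner_smul_left, inner_tangentIsometry,
      LinearIsometry.inner_map_map]
    ring
  rw [hab, hS]
  simp only [inner_sub_left, inner_sub_right, real_inner_smul_left, real_inner_smul_right,
    inner_tangentIsometry, tangentIsometry_inner, hxx, LinearIsometry.inner_map_map]
  ring

theorem normSqCovDeriv_eq (hσ : ContMDiff (𝓡 m) (𝓡 m).tangent ∞ (toMap (𝓡 m) σ))
    (x : Sph m) (w : EuclideanSpace ℝ (Fin m)) (hw : w = σ x)
    {ι : Type*} [Fintype ι] (e : OrthonormalBasis ι ℝ (EuclideanSpace ℝ (Fin m))) :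
    normSqCovDeriv (𝓡 m) (roundMetric m) σ x =
      ∑ i, ⟪fderiv ℝ (ambientField σ x) 0 (e i), fderiv ℝ (ambientField σ x) 0 (e i)⟫
        - ‖w‖ ^ 2 := by
  let L := fderiv ℝ (chartField (𝓡 m) σ x) 0
  have hg : ∀ u v : EuclideanSpace ℝ (Fin m), roundMetric m x
      (covDeriv (𝓡 m) (roundMetric m) σ x u) (covDeriv (𝓡 m) (roundMetric m) σ x v)
      = ⟪L u, L v⟫ := by
    intro u v
    refine (roundMetric_at_apply x _ _).trans ?_
    rw [covDeriv_eq, covDeriv_eq]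
  refine (metricTrace_eq_sum (MetricTensor.at (𝓡 m) (roundMetric m) x) (roundMetric_at_apply x)
    (fun u v => roundMetric m x (covDeriv (𝓡 m) (roundMetric m) σ x u)
      (covDeriv (𝓡 m) (roundMetric m) σ x v))
    ((innerSL ℝ).bilinearComp L L).toLinearMap₁₂ hg e).trans ?_
  simp only [hg, L, inner_fderiv_ambientField hσ x _ w hw, Finset.sum_sub_distrib]
  congr 1
  rw [← real_inner_self_eq_norm_sq, ← e.sum_inner_mul_inner w w]
  exact Finset.sum_congr rfl fun i _ => by rw [sq, real_inner_comm w]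

theorem covDeriv₂_eq (x : Sph m) (u v : EuclideanSpace ℝ (Fin m)) :
    covDeriv₂ (𝓡 m) (roundMetric m) σ x u v =
      fderiv ℝ (fun z => chartCovDeriv (𝓡 m) (roundMetric m) σ x z v) 0 u := by
  change fderiv ℝ (fun z => chartCovDeriv (𝓡 m) (roundMetric m) σ x z v) (extChartAt (𝓡 m) x x) u
    + christoffel (𝓡 m) (roundMetric m) x (extChartAt (𝓡 m) x x) u
      (chartCovDeriv (𝓡 m) (roundMetric m) σ x (extChartAt (𝓡 m) x x) v)
    - chartCovDeriv (𝓡 m) (roundMetric m) σ x (extChartAt (𝓡 m) x x)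
      (christoffel (𝓡 m) (roundMetric m) x (extChartAt (𝓡 m) x x) u v) = _
  rw [extChartAt_self_sphere, christoffel_zero]
  simp [chartCovDeriv]

/-- Differentiate the Gauss formula. The extra term pairs the normal part -⟪v, w⟫x of D_vS with
D²F(u, d) = -⟪u, d⟫x. -/
theorem inner_covDeriv₂ (hσ : ContMDiff (𝓡 m) (𝓡 m).tangent ∞ (toMap (𝓡 m) σ))
    (x : Sph m) (w : EuclideanSpace ℝ (Fin m)) (hw : w = σ x)
    (u v d : EuclideanSpace ℝ (Fin m)) :
    ⟪fderiv ℝ (fun z => chartCovDeriv (𝓡 m) (roundMetric m) σ x z v) 0 u, d⟫ =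
      ⟪fderiv ℝ (fderiv ℝ (ambientField σ x)) 0 u v, tangentIsometry x d⟫
      + ⟪v, w⟫ * ⟪u, d⟫ := by
  have hS : ContDiff ℝ 2 (ambientField σ x) := (contDiff_ambientField hσ x).of_le (by norm_cast)
  have hS1 : ContDiff ℝ 1 fun y => fderiv ℝ (ambientField σ x) y v :=
    (hS.fderiv_right (m := 1) (by norm_num)).clm_apply contDiff_const
  have hF1 : ∀ d, ContDiff ℝ 1 fun y => fderiv ℝ (sphereParam x) y d := fun d =>
    ((contDiff_sphereParam x (n := 2)).fderiv_right (m := 1) (by norm_num)).clm_apply contDiff_const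
  have hf : ∀ y d, (4 * (‖y‖ ^ 2 + 4)⁻¹) ^ 2 * ⟪chartCovDeriv (𝓡 m) (roundMetric m) σ x y v, d⟫
      = ⟪fderiv ℝ (ambientField σ x) y v, fderiv ℝ (sphereParam x) y d⟫ := by
    intro y d
    rw [← inner_fderiv_sphereParam, inner_fderiv_chartCovDeriv hσ]
  have hd : DifferentiableAt ℝ (fun y => chartCovDeriv (𝓡 m) (roundMetric m) σ x y v) 0 :=
    (contDiff_of_conformal_inner (fun d => hS1.inner ℝ (hF1 d)) hf).differentiable (by norm_num) 0
  rw [inner_fderiv_zero_of_conformal_inner hd (fun y => hf y d),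
    fderiv_inner_apply ℝ (hS1.differentiable (by norm_num) 0)
      ((hF1 d).differentiable (by norm_num) 0), fderiv_fderiv_apply hS,
    fderiv_fderiv_apply (contDiff_sphereParam x)]
  have h1 : fderiv ℝ (sphereParam x) 0 d = tangentIsometry x d := fderiv_stereoParam_zero _ _ _
  have h2 : fderiv ℝ (fderiv ℝ (sphereParam x)) 0 u d = -⟪u, d⟫ • (x : Ambient m) :=
    fderiv_fderiv_stereoParam_zero _ _ u d
  rw [h1, h2, real_inner_smul_right, real_inner_comm (x : Ambient m),
    inner_fderiv_ambientField_base hσ x v w hw]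
  ring

theorem inner_roughLaplacian (hσ : ContMDiff (𝓡 m) (𝓡 m).tangent ∞ (toMap (𝓡 m) σ))
    (x : Sph m) (w : EuclideanSpace ℝ (Fin m)) (hw : w = σ x)
    {ι : Type*} [Fintype ι] (e : OrthonormalBasis ι ℝ (EuclideanSpace ℝ (Fin m)))
    (d a : EuclideanSpace ℝ (Fin m)) (ha : a = roughLaplacian (𝓡 m) (roundMetric m) σ x) :
    ⟪a, d⟫ = -(∑ i, ⟪fderiv ℝ (fderiv ℝ (ambientField σ x)) 0 (e i) (e i), tangentIsometry x d⟫
      + ⟪w, d⟫) := by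
  -- The adjoint of the isometry extracts tangential parts and so writes ∇²σ as an explicit bilinear
  -- map.
  let T : Ambient m →L[ℝ] EuclideanSpace ℝ (Fin m) :=
    (tangentIsometry x).toContinuousLinearMap.adjoint
  let S2 := fderiv ℝ (fderiv ℝ (ambientField σ x)) 0
  let B : EuclideanSpace ℝ (Fin m) →ₗ[ℝ] EuclideanSpace ℝ (Fin m) →ₗ[ℝ] EuclideanSpace ℝ (Fin m) :=
    LinearMap.mk₂ ℝ (fun u v => T (S2 u v) + ⟪v, w⟫ • u)
      (fun u u' v => by simp only [map_add, add_apply]; module)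
      (fun c u v => by simp only [map_smul, smul_apply]; module)
      (fun u v v' => by simp only [map_add, inner_add_left]; module)
      (fun c u v => by simp only [map_smul, real_inner_smul_left]; module)
  have hB : ∀ u v, fderiv ℝ (fun z => chartCovDeriv (𝓡 m) (roundMetric m) σ x z v) 0 u = B u v := by
    intro u v
    refine ext_inner_right ℝ fun d => ?_
    rw [inner_covDeriv₂ hσ x w hw u v d]
    change _ = ⟪T (S2 u v) + ⟪v, w⟫ • u, d⟫
    rw [inner_add_left, real_inner_smul_left, ContinuousLinearMap.adjoint_inner_left]
    rfl
  have h : a = -∑ i, fderiv ℝ (fun z => chartCovDeriv (𝓡 m) (roundMetric m) σ x z (e i)) 0 (e i) := by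
    have h1 := metricTrace_eq_sum (F := EuclideanSpace ℝ (Fin m))
      (MetricTensor.at (𝓡 m) (roundMetric m) x) (roundMetric_at_apply x)
      (covDeriv₂ (𝓡 m) (roundMetric m) σ x) B (fun u v => (covDeriv₂_eq x u v).trans (hB u v)) e
    rw [ha]
    refine (congrArg Neg.neg h1).trans ?_
    exact congrArg Neg.neg (Finset.sum_congr rfl fun i _ => covDeriv₂_eq x (e i) (e i))
  rw [h, inner_neg_left, sum_inner,
    Finset.sum_congr rfl fun i _ => inner_covDeriv₂ hσ x w hw (e i) (e i) d,
    Finset.sum_add_distrib, ← e.sum_inner_mul_inner w d]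
  simp only [real_inner_comm w]

end CovariantDerivatives

/-! ### The section equation for constant norm -/

section ConstantNorm

variable {m : ℕ} {σ : ∀ x : Sph m, TangentSpace (𝓡 m) x}

theorem normSq_eq (x : Sph m) (w : EuclideanSpace ℝ (Fin m)) (hw : w = σ x) :
    normSq (𝓡 m) (roundMetric m) σ x = ‖w‖ ^ 2 := by
  rw [← real_inner_self_eq_norm_sq, hw]
  exact roundMetric_at_apply x (σ x) (σ x)

theorem gradient_const (c : ℝ) (x : Sph m) :
    gradient (𝓡 m) (roundMetric m) (fun _ => c) x = (0 : EuclideanSpace ℝ (Fin m)) := by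
  unfold gradient
  rw [mfderiv_const]
  exact map_zero (MetricTensor.at (𝓡 m) (roundMetric m) x).inverse

theorem laplacian_const (c : ℝ) (x : Sph m) :
    laplacian (𝓡 m) (roundMetric m) (fun _ => c) x = 0 := by
  have h : (fun _ : Sph m => c) ∘ (extChartAt (𝓡 m) x).symm = fun _ => c := rfl
  simp only [laplacian, h]
  simp [metricTrace]

/-- The equation of harmonic sections for vector fields of constant norm, in terms of the embedding
of the tangent bundle. -/
theorem sectionEquation_ambientField
    (hσ : ContMDiff (𝓡 m) (𝓡 m).tangent ∞ (toMap (𝓡 m) σ))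
    {c : ℝ} (hc : ∀ x, normSq (𝓡 m) (roundMetric m) σ x = c) {p q : ℝ}
    (hS : SectionEquation (𝓡 m) (roundMetric m) p q σ) (x : Sph m)
    (w : EuclideanSpace ℝ (Fin m)) (hw : w = σ x)
    {ι : Type*} [Fintype ι] (e : OrthonormalBasis ι ℝ (EuclideanSpace ℝ (Fin m)))
    (d : EuclideanSpace ℝ (Fin m)) :
    ∑ i, ⟪fderiv ℝ (fderiv ℝ (ambientField σ x)) 0 (e i) (e i), tangentIsometry x d⟫
      + ⟪w, d⟫ + p * (1 + ‖w‖ ^ 2)⁻¹ * ⟪w, d⟫ *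
        (∑ i, ⟪fderiv ℝ (ambientField σ x) 0 (e i), fderiv ℝ (ambientField σ x) 0 (e i)⟫
          - ‖w‖ ^ 2) = 0 := by
  obtain ⟨a, ha⟩ : ∃ a : EuclideanSpace ℝ (Fin m), a = roughLaplacian (𝓡 m) (roundMetric m) σ x :=
    ⟨_, rfl⟩
  have he : (fun x => normSq (𝓡 m) (roundMetric m) σ x / 2) = fun _ => c / 2 :=
    funext fun x => by rw [hc]
  have hE : (1 + normSq (𝓡 m) (roundMetric m) σ x) • a
      = (p * normSqCovDeriv (𝓡 m) (roundMetric m) σ x) • w := by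
    have h := hS x
    simp only [he] at h
    rw [gradient_const, laplacian_const] at h
    have h0 : covDeriv (𝓡 m) (roundMetric m) σ x (0 : EuclideanSpace ℝ (Fin m))
        = (0 : EuclideanSpace ℝ (Fin m)) := by
      rw [covDeriv_eq, map_zero]
    have hz : roundMetric m x (0 : EuclideanSpace ℝ (Fin m)) (0 : EuclideanSpace ℝ (Fin m)) = 0 :=
      (roundMetric_at_apply x 0 0).trans (inner_zero_left 0)
    rw [h0] at h
    rw [ha, hw]
    -- Stated for vectors of the model space, so that the algebra does not depend on the type
    -- `TangentSpace`.
    have h2 : ∀ (s t r z : ℝ) (b b' : EuclideanSpace ℝ (Fin m)), z = 0 →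
        s • b + r • (0 : EuclideanSpace ℝ (Fin m)) = (t - p * q * z - q * s * 0) • b' →
          s • b = t • b' := by
      rintro s t r z b b' rfl h
      simpa using h
    exact h2 _ _ _ _ _ _ hz h
  have hd := congrArg (fun b => ⟪b, d⟫) hE
  simp only [real_inner_smul_left] at hd
  rw [inner_roughLaplacian hσ x w hw e d a ha, normSqCovDeriv_eq hσ x w hw e,
    normSq_eq x w hw] at hd
  have hpos : (1 + ‖w‖ ^ 2) ≠ 0 := by positivity
  field_simp
  linarith

theorem isHarmonicMap_toMap
    (hσ : ContMDiff (𝓡 m) (𝓡 m).tangent ∞ (toMap (𝓡 m) σ))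
    {c : ℝ} (hc : ∀ x, normSq (𝓡 m) (roundMetric m) σ x = c) {p q : ℝ} (hq : 0 ≤ q)
    (hK : IsKilling (𝓡 m) (roundMetric m) σ)
    (hS : SectionEquation (𝓡 m) (roundMetric m) p q σ) :
    IsHarmonicMap (𝓡 m) (𝓡 m).tangent (roundMetric m)
      (cheegerGromoll (𝓡 m) (roundMetric m) p q) (toMap (𝓡 m) σ) :=
  ⟨hσ, fun x => tensionField_eq_zero hσ hc hq x (killing_ambientField hσ hK x)
    (EuclideanSpace.basisFun (Fin m) ℝ) (σ x) rfl fun d =>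
      sectionEquation_ambientField hσ hc hS x (σ x) rfl (EuclideanSpace.basisFun (Fin m) ℝ) d⟩

end ConstantNorm

/-! ### Hopf vector fields -/

section HopfFields

variable {m : ℕ} {J : Ambient m →ₗᵢ[ℝ] Ambient m} (hJ : ∀ x, J (J x) = -x)
include hJ

theorem inner_complexStructure_left (u v : Ambient m) : ⟪J u, v⟫ = -⟪u, J v⟫ := by
  have h := J.inner_map_map u (J v)
  rw [hJ, inner_neg_right] at h
  linarith

theorem ambientField_hopfField (k : ℝ) (x : Sph m) :
    ambientField (hopfField m J k) x = fun y => (k • J.toContinuousLinearMap) (sphereParam x y) := by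
  funext y
  rw [ambientField_eq, ← coe_extChartAt_symm]
  exact dIncl_hopfField m J hJ k _

theorem fderiv_ambientField_hopfField (k : ℝ) (x : Sph m) (y u : EuclideanSpace ℝ (Fin m)) :
    fderiv ℝ (ambientField (hopfField m J k) x) y u = k • J (fderiv ℝ (sphereParam x) y u) := by
  rw [ambientField_hopfField hJ]
  have h := (((k • J.toContinuousLinearMap).hasFDerivAt).comp y
    (differentiable_sphereParam x y).hasFDerivAt).fderiv
  exact congrArg (fun L => L u) h

theorem fderiv_fderiv_ambientField_hopfField (k : ℝ) (x : Sph m)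
    (u v : EuclideanSpace ℝ (Fin m)) :
    fderiv ℝ (fderiv ℝ (ambientField (hopfField m J k) x)) 0 u v
      = -⟪u, v⟫ • (k • J (x : Ambient m)) := by
  have h : ambientField (hopfField m J k) x
      = fun y => (k • J.toContinuousLinearMap) (sphereParam x y) := ambientField_hopfField hJ k x
  have h2 : fderiv ℝ (fderiv ℝ (sphereParam x)) 0 u v = -⟪u, v⟫ • (x : Ambient m) :=
    fderiv_fderiv_stereoParam_zero _ _ u v
  have h3 : fderiv ℝ (fderiv ℝ (k • J.toContinuousLinearMap : Ambient m →L[ℝ] Ambient m))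
      (sphereParam x 0) = 0 := by
    have : fderiv ℝ (k • J.toContinuousLinearMap : Ambient m →L[ℝ] Ambient m)
        = fun _ => k • J.toContinuousLinearMap := funext fun y => ContinuousLinearMap.fderiv _
    rw [this]
    simp
  rw [h, fderiv_fderiv_comp (k • J.toContinuousLinearMap).contDiff (contDiff_sphereParam x), h2,
    h3, ContinuousLinearMap.fderiv, map_smul]
  simp only [zero_apply, zero_add]
  rfl

/-- The field is a chosen preimage under `dIncl`, so its smoothness is read off from that of its
image kJF. -/
theorem contDiff_chartField_hopfField (k : ℝ) (x : Sph m) :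
    ContDiff ℝ ∞ (chartField (𝓡 m) (hopfField m J k) x) := by
  have h1 : ContDiff ℝ ∞ (ambientField (hopfField m J k) x) := by
    rw [ambientField_hopfField hJ]
    exact (k • J.toContinuousLinearMap).contDiff.comp (contDiff_sphereParam x)
  have h2 : ∀ w, ContDiff ℝ ∞ fun y => fderiv ℝ (sphereParam x) y w := fun w =>
    ((contDiff_sphereParam x (n := ∞)).fderiv_right (by norm_num)).clm_apply contDiff_const
  exact contDiff_of_conformal_inner (fun w => h1.inner ℝ (h2 w)) fun y w =>
    (inner_fderiv_sphereParam x y _ w).symm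

theorem contMDiff_hopfField (k : ℝ) :
    ContMDiff (𝓡 m) (𝓡 m).tangent ∞ (toMap (𝓡 m) (hopfField m J k)) := by
  intro x
  refine (Bundle.contMDiffAt_section (IB := 𝓡 m) (F := EuclideanSpace ℝ (Fin m)) x).2 ?_
  have h1 : ContMDiffAt (𝓡 m) 𝓘(ℝ, EuclideanSpace ℝ (Fin m)) ∞
      (fun x' => chartField (𝓡 m) (hopfField m J k) x (extChartAt (𝓡 m) x x')) x :=
    (contDiff_chartField_hopfField hJ k x).contMDiff.contMDiffAt.comp x
      (contMDiffAt_extChartAt (I := 𝓡 m) (n := ∞))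
  refine h1.congr_of_eventuallyEq ?_
  filter_upwards [extChartAt_source_mem_nhds (I := 𝓡 m) x] with x' hx'
  have h2 : (extChartAt (𝓡 m) x).symm (extChartAt (𝓡 m) x x') = x' :=
    (extChartAt (𝓡 m) x).left_inv hx'
  have h3 := extChartAt_tangent_apply (toMap (𝓡 m) (hopfField m J k) x)
    (toMap (𝓡 m) (hopfField m J k) x') (by rwa [← extChartAt_source (𝓡 m)])
  unfold chartField
  rw [h2]
  exact congrArg Prod.snd h3

theorem normSq_hopfField (k : ℝ) (x : Sph m) :
    normSq (𝓡 m) (roundMetric m) (hopfField m J k) x = k ^ 2 := by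
  have h := dIncl_hopfField m J hJ k x
  change ⟪dIncl m x (hopfField m J k x), dIncl m x (hopfField m J k x)⟫ = _
  rw [h, real_inner_smul_left, real_inner_smul_right, J.inner_map_map, real_inner_self_eq_norm_sq,
    norm_coe_sphere]
  ring

/-- Hopf vector fields of the critical length are harmonic maps. -/
theorem isHarmonicMap_hopfField {p q k : ℝ} (hp : 1 < p) (hq : 0 ≤ q) (hk : k ^ 2 = 1 / (p - 1)) :
    IsHarmonicMap (𝓡 m) (𝓡 m).tangent (roundMetric m)
      (cheegerGromoll (𝓡 m) (roundMetric m) p q) (toMap (𝓡 m) (hopfField m J k)) := by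
  have hσ := contMDiff_hopfField hJ k
  refine ⟨hσ, fun x => ?_⟩
  obtain ⟨w, hw⟩ : ∃ w : EuclideanSpace ℝ (Fin m), w = hopfField m J k x := ⟨_, rfl⟩
  have hι : ∀ u, fderiv ℝ (sphereParam x) 0 u = tangentIsometry x u := fderiv_stereoParam_zero _ _
  refine tensionField_eq_zero hσ (normSq_hopfField hJ k) hq x ?_
    (EuclideanSpace.basisFun (Fin m) ℝ) w hw ?_
  · intro u v
    rw [fderiv_ambientField_hopfField hJ, fderiv_ambientField_hopfField hJ, hι, hι,
      real_inner_smul_left, real_inner_smul_right, inner_complexStructure_left hJ]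
    ring
  · intro d
    have hw2 : ‖w‖ ^ 2 = k ^ 2 := by rw [← normSq_eq x w hw, normSq_hopfField hJ]
    have h0 : k • J (x : Ambient m) = tangentIsometry x w := by
      rw [← dIncl_hopfField m J hJ k x, hw, dIncl_eq]
      rfl
    have hp1 : p - 1 ≠ 0 := by linarith
    -- This is where the critical length enters: k² = 1/(p - 1) gives 1 + k² = p/(p - 1).
    have hpk : p * (1 + k ^ 2)⁻¹ * k ^ 2 = 1 := by
      have hp0 : p ≠ 0 := by linarith
      have h1 : 1 + k ^ 2 = p / (p - 1) := by
        rw [hk]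
        field_simp
        ring
      rw [h1, hk]
      field_simp
    have hnorm : ∀ u, ⟪k • J (tangentIsometry x u), k • J (tangentIsometry x u)⟫
        = k ^ 2 * ‖u‖ ^ 2 := by
      intro u
      rw [real_inner_smul_left, real_inner_smul_right, J.inner_map_map,
        LinearIsometry.inner_map_map, real_inner_self_eq_norm_sq]
      ring
    simp only [fderiv_ambientField_hopfField hJ, fderiv_fderiv_ambientField_hopfField hJ, hι, h0,
      hw2, hnorm, real_inner_smul_left, LinearIsometry.inner_map_map,
      real_inner_self_eq_norm_sq, OrthonormalBasis.norm_eq_one, Finset.sum_const, Finset.card_univ,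
      Fintype.card_fin, nsmul_eq_mul]
    -- The trace of D²S plus w is (1 - m)w, and |∇σ|² = mk² - k², so m - 1 factors out.
    linear_combination ((m : ℝ) - 1) * ⟪w, d⟫ * hpk

end HopfFields

end HarmonicHopf

end

open HarmonicHopf in
theorem mainTheorem3 :
    (∀ (n : ℕ) (p q k : ℝ), 1 < p → 0 ≤ q → k ^ 2 = 1 / (p - 1) →
      ∀ J : Ambient (2 * n + 1) →ₗᵢ[ℝ] Ambient (2 * n + 1), (∀ x, J (J x) = -x) →
        IsHarmonicMap (𝓡 (2 * n + 1)) (𝓡 (2 * n + 1)).tangent (roundMetric (2 * n + 1))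
          (cheegerGromoll (𝓡 (2 * n + 1)) (roundMetric (2 * n + 1)) p q)
          (toMap (𝓡 (2 * n + 1)) (hopfField (2 * n + 1) J k))) ∧
    (∀ (m : ℕ) (p q : ℝ), 0 ≤ q →
      ∀ σ : ∀ x : Sph m, TangentSpace (𝓡 m) x,
        ContMDiff (𝓡 m) (𝓡 m).tangent ∞ (toMap (𝓡 m) σ) →
        IsKilling (𝓡 m) (roundMetric m) σ →
        (∃ c : ℝ, ∀ x, normSq (𝓡 m) (roundMetric m) σ x = c) →
          (∀ x, dProj (𝓡 m) (toMap (𝓡 m) σ x)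
            (tensionField (𝓡 m) (𝓡 m).tangent (roundMetric m)
              (cheegerGromoll (𝓡 m) (roundMetric m) p q) (toMap (𝓡 m) σ) x) = 0) ∧
          (SectionEquation (𝓡 m) (roundMetric m) p q σ →
            IsHarmonicMap (𝓡 m) (𝓡 m).tangent (roundMetric m)
              (cheegerGromoll (𝓡 m) (roundMetric m) p q) (toMap (𝓡 m) σ))) := by
  refine ⟨fun n p q k hp hq hk J hJ => isHarmonicMap_hopfField hJ hp hq hk, ?_⟩
  rintro m p q hq σ hσ hK ⟨c, hc⟩
  exact ⟨fun x => fst_tensionField_eq_zero hσ hc hq x (killing_ambientField hσ hK x),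
    fun hS => isHarmonicMap_toMap hσ hc hq hK hS⟩
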